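/- Let $(\mathbb K,|\cdot|)$ be a complete ultrametric field with non-trivial absolute value, and let $E$ be a Hausdorff topological $\mathbb K$-vector space which is locally convex, i.e. the open $\mathbb O$-submodules of $E$ form a basis of $0$-neighbourhoods, where $\mathbb O=\{z\in\mathbb K:|z|\le 1\}$. Let $\ell\ge 1$, $n_1,\dots,n_\ell\ge 1$, $n=n_1+\dots+n_\ell$, and $\alpha\in(\mathbb N_0\cup\{\infty\})^\ell$. Let $N_\alpha$ be the set of all $\beta=(\beta_1,\dots,\beta_\ell)\in\mathbb N_0^{n_1}\times\dots\times\mathbb N_0^{n_\ell}=\mathbb N_0^n$ with $|\beta_j|\le\alpha_j$ for all $j$. A subset of $\mathbb K^n$ is called cartesian if it is of the form $V_1\times\dots\times V_n$ with subsets $V_i\subseteq\mathbb K$ without isolated points, and locally cartesian if each of its points has a relatively open neighbourhood in it which is cartesian. Let $U\subseteq\mathbb K^{n_1}\times\dots\times\mathbb K^{n_\ell}=\mathbb K^n$ be locally closed and locally cartesian. For $V\subseteq\mathbb K^n$ and $\beta\in\mathbb N_0^n$, let $V^{<\beta>}$ be the set of all $x=(x^{(1)},\dots,x^{(n)})$ with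 $x^{(i)}=(x^{(i)}_0,\dots,x^{(i)}_{\beta_i})\in\mathbb K^{1+\beta_i}$ such that $(x^{(1)}_{j_1},\dots,x^{(n)}_{j_n})\in V$ for all $j_1\in\{0,\dots,\beta_1\},\dots,j_n\in\{0,\dots,\beta_n\}$, and let $V^{>\beta<}$ be the set of those $x\in V^{<\beta>}$ for which the entries of each $x^{(i)}$ are pairwise distinct. For $g\colon V\to E$ and $x\in V^{>\beta<}$ put $$g^{>\beta<}(x)=\sum_{j_1=0}^{\beta_1}\cdots\sum_{j_n=0}^{\beta_n}\Bigl(\prod_{i=1}^n\prod_{k\ne j_i}\frac1{x^{(i)}_{j_i}-x^{(i)}_k}\Bigr)\,g(x^{(1)}_{j_1},\dots,x^{(n)}_{j_n}).$$ For $\beta\in\mathbb N_0^n$, a map $f\colon U\to E$ is called $C^\beta$ if for each relatively open cartesian subset $V\subseteq U$ and each $\gamma\in\mathbb N_0^n$ with $\gamma\le\beta$, the map $(f|_V)^{>\gamma<}$ has a (necessarily unique) continuous extension $(f|_V)^{<\gamma>}\colon V^{<\gamma>}\to E$. The space $C^\beta(U,E)$ of all such maps carries the initial topology with respect to the maps $f\mapsto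 (f|_V)^{<\gamma>}\in C(V^{<\gamma>},E)$ for all such $V$ and $\gamma$, where $C(V^{<\gamma>},E)$ carries the compact-open topology. Let $C^\alpha(U,E)=\bigcap_{\beta\in N_\alpha}C^\beta(U,E)$, with the initial topology with respect to the inclusion maps into the spaces $C^\beta(U,E)$, $\beta\in N_\alpha$. Let $\mathrm{LocPol}_{\le\alpha}(U,E)$ be the set of all functions $f\colon U\to E$ such that each point of $U$ has a relatively open neighbourhood $V$ in $U$ on which $f$ is given by a finite sum $f(x)=\sum_{\beta\in N_\alpha}x^\beta a_\beta$ with $a_\beta\in E$ (all but finitely many of them zero). Then $\mathrm{LocPol}_{\le\alpha}(U,E)$ is contained in $C^\alpha(U,E)$ and is dense in $C^\alpha(U,E)$. -/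

import Mathlib

open Set Topology

noncomputable section

namespace CAlpha

/-- A topological vector space over an ultrametric field `K` is locally convex if the open
submodules over the valuation ring `{z : ‖z‖ ≤ 1}` form a basis of the neighbourhoods of `0`. -/
def IsLocallyConvex (K E : Type*) [NormedField K] [IsUltrametricDist K]
    [AddCommGroup E] [Module K E] [TopologicalSpace E] : Prop :=
  (𝓝 (0 : E)).HasBasis
    (fun W : Submodule (NormedField.valuation (K := K)).integer E => IsOpen (W : Set E))
    (fun W => (W : Set E))

section Domains

variable {ι K : Type*} [TopologicalSpace K]

/-- A product of subsets of `K` without isolated points. -/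
def IsCartesian (U : Set (ι → K)) : Prop :=
  ∃ s : ι → Set K, (∀ i, Preperfect (s i)) ∧ U = univ.pi s

/-- `V` is a relatively open subset of `U`, and is cartesian. -/
def IsOpenCartesianIn (V U : Set (ι → K)) : Prop :=
  (∃ O : Set (ι → K), IsOpen O ∧ V = U ∩ O) ∧ IsCartesian V

theorem IsOpenCartesianIn.subset {V U : Set (ι → K)} (h : IsOpenCartesianIn V U) : V ⊆ U := by
  obtain ⟨⟨O, -, rfl⟩, -⟩ := h
  exact inter_subset_left

/-- Every point of `U` has a relatively open neighbourhood in `U` which is cartesian. -/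
def IsLocallyCartesian (U : Set (ι → K)) : Prop :=
  ∀ x ∈ U, ∃ V, IsOpenCartesianIn V U ∧ x ∈ V

end Domains

section Quotients

variable {ι K E : Type*}

/-- The domain `U^{<β>}`: all `x = (x⁽ⁱ⁾)ᵢ` with `x⁽ⁱ⁾ = (x⁽ⁱ⁾₀, …, x⁽ⁱ⁾_{βᵢ})` such that every
selection of one entry from each `x⁽ⁱ⁾` gives a point of `U`. -/
def extDom (U : Set (ι → K)) (β : ι → ℕ) : Set ((i : ι) → Fin (β i + 1) → K) :=
  {x | ∀ j : (i : ι) → Fin (β i + 1), (fun i => x i (j i)) ∈ U}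

/-- The difference quotient `f^{>β<}`. Only its values on the set `U^{>β<}` of those `x` for
which the entries of each `x⁽ⁱ⁾` are pairwise distinct will be used. -/
def diffQuot [Fintype ι] [Field K] [AddCommGroup E] [Module K E] {U : Set (ι → K)}
    (f : U → E) (β : ι → ℕ) (x : extDom U β) : E :=
  open Classical in
  ∑ j : (i : ι) → Fin (β i + 1),
    (∏ i, ∏ k ∈ Finset.univ.erase (j i), (x.1 i (j i) - x.1 i k)⁻¹) •
      f ⟨fun i => x.1 i (j i), x.2 j⟩

variable [TopologicalSpace K] [TopologicalSpace E]

/-- `g : U^{<β>} → E` is a continuous extension of `f^{>β<}`, which lives on `U^{>β<}`. -/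
def IsExtension [Fintype ι] [Field K] [AddCommGroup E] [Module K E] {U : Set (ι → K)}
    (f : U → E) (β : ι → ℕ) (g : C(extDom U β, E)) : Prop :=
  ∀ x : extDom U β, (∀ i, Function.Injective (x.1 i)) → g x = diffQuot f β x

/-- If `U` is cartesian, then `U^{>β<}` is dense in `U^{<β>}`. -/
theorem dense_injective [T1Space K] {U : Set (ι → K)} (hU : IsCartesian U) (β : ι → ℕ) :
    Dense {x : extDom U β | ∀ i, Function.Injective (x.1 i)} := by
  obtain ⟨s, hs, rfl⟩ := hU
  have key : ∀ (i : ι) (m : ℕ) (y : Fin m → K), (∀ k, y k ∈ s i) →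
      ∀ O : Fin m → Set K, (∀ k, O k ∈ 𝓝 (y k)) →
      ∃ z : Fin m → K, (∀ k, z k ∈ O k ∩ s i) ∧ Function.Injective z := by
    intro i m
    induction m with
    | zero => exact fun y _ O _ => ⟨y, fun k => k.elim0, fun k => k.elim0⟩
    | succ m ih =>
      intro y hy O hO
      obtain ⟨z, hz, hinj⟩ := ih (fun k => y k.succ) (fun k => hy _) (fun k => O k.succ)
        (fun k => hO _)
      have hinf : (O 0 ∩ s i).Infinite :=
        Set.Infinite.of_accPt ((hs i _ (hy 0)).nhds_inter (hO 0))
      obtain ⟨w, hw, hwz⟩ := hinf.exists_notMem_finite (finite_range z)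
      exact ⟨Fin.cons w z, fun k => by refine Fin.cases ?_ (fun k => ?_) k <;> simp [hw, hz],
        Fin.cons_injective_iff.2 ⟨hwz, hinj⟩⟩
  intro x
  rw [mem_closure_iff_nhds]
  intro N hN
  obtain ⟨N', hN', hsub⟩ := mem_nhds_subtype _ _ _ |>.1 hN
  rw [nhds_pi, Filter.mem_pi] at hN'
  obtain ⟨I, -, t, ht, hI⟩ := hN'
  have ht' : ∀ i, ∃ O : Fin (β i + 1) → Set K, (∀ k, O k ∈ 𝓝 (x.1 i k)) ∧ univ.pi O ⊆ t i := by
    intro i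
    have h := ht i
    rw [nhds_pi, Filter.mem_pi] at h
    obtain ⟨J, -, O, hO, hJ⟩ := h
    exact ⟨O, hO, fun z hz => hJ fun k _ => hz k trivial⟩
  choose O hO hOt using ht'
  have hx : ∀ i k, x.1 i k ∈ s i := by
    intro i k
    classical
    simpa using x.2 (Function.update (fun _ => 0) i k) i trivial
  choose z hz hinj using fun i => key i _ (x.1 i) (hx i) (O i) (hO i)
  refine ⟨⟨z, fun j i _ => (hz i (j i)).2⟩, hsub ?_, hinj⟩
  exact hI fun i _ => hOt i fun k _ => (hz i k).1

/-- On cartesian sets, a continuous extension of `f^{>β<}` is unique. -/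
theorem IsExtension.unique [Fintype ι] [Field K] [AddCommGroup E] [Module K E] [T1Space K]
    [T2Space E] {U : Set (ι → K)} (hU : IsCartesian U) {f : U → E} {β : ι → ℕ}
    {g h : C(extDom U β, E)} (hg : IsExtension f β g) (hh : IsExtension f β h) : g = h :=
  ContinuousMap.coe_injective <| Continuous.ext_on (dense_injective hU β) g.continuous
    h.continuous fun x hx => (hg x hx).trans (hh x hx).symm

end Quotients

section Spaces

variable {ι K E : Type*} [Fintype ι] [Field K] [TopologicalSpace K]
  [AddCommGroup E] [Module K E] [TopologicalSpace E]

/-- `f|_V` for `V ⊆ U`. -/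
def restr {U V : Set (ι → K)} (h : V ⊆ U) (f : U → E) : V → E := fun v => f (inclusion h v)

/-- `f : U → E` is `C^α`, where `α ∈ (ℕ₀ ∪ {∞})^ι`: for each relatively open cartesian subset
`V ⊆ U` and each finite multi-index `β ≤ α`, the map `(f|_V)^{>β<}` has a continuous extension
to `V^{<β>}`. -/
def IsC (U : Set (ι → K)) (α : ι → ℕ∞) (f : U → E) : Prop :=
  ∀ (V : Set (ι → K)) (hV : IsOpenCartesianIn V U) (β : ι → ℕ), (∀ i, (β i : ℕ∞) ≤ α i) →
    ∃ g : C(extDom V β, E), IsExtension (restr hV.subset f) β g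

/-- The space `C^α(U, E)` for `α ∈ (ℕ₀ ∪ {∞})^ι`. -/
structure CSpace (U : Set (ι → K)) (E : Type*) [AddCommGroup E] [Module K E]
    [TopologicalSpace E] (α : ι → ℕ∞) where
  toFun : U → E
  isC : IsC U α toFun

/-- The map `Δ_{β,V} : C^α(U, E) → C(V^{<β>}, E)`, `f ↦ (f|_V)^{<β>}`. -/
def Δ {U : Set (ι → K)} {α : ι → ℕ∞} {V : Set (ι → K)} (hV : IsOpenCartesianIn V U)
    {β : ι → ℕ} (hβ : ∀ i, (β i : ℕ∞) ≤ α i) (f : CSpace U E α) : C(extDom V β, E) :=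
  (f.isC V hV β hβ).choose

theorem Δ_spec {U : Set (ι → K)} {α : ι → ℕ∞} {V : Set (ι → K)} (hV : IsOpenCartesianIn V U)
    {β : ι → ℕ} (hβ : ∀ i, (β i : ℕ∞) ≤ α i) (f : CSpace U E α) :
    IsExtension (restr hV.subset f.toFun) β (Δ hV hβ f) :=
  (f.isC V hV β hβ).choose_spec

/-- The compact-open `C^α`-topology: the initial topology with respect to all the maps `Δ_{β,V}`,
where `C(V^{<β>}, E)` carries the compact-open topology. -/
instance (U : Set (ι → K)) (α : ι → ℕ∞) : TopologicalSpace (CSpace U E α) :=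
  ⨅ (V : Set (ι → K)) (hV : IsOpenCartesianIn V U) (β : ι → ℕ)
    (hβ : ∀ i, (β i : ℕ∞) ≤ α i), TopologicalSpace.induced (Δ hV hβ) inferInstance

end Spaces

section Blocks

/-! From now on, `K^{n_1} × ⋯ × K^{n_ℓ} = K^n` is the space of functions on the index set
`Σ j, Fin (n j)` of all pairs of a block `j` and a position within this block. -/

variable {K E : Type*} [Field K] [TopologicalSpace K]
  [AddCommGroup E] [Module K E] [TopologicalSpace E] {ℓ : ℕ} {n : Fin ℓ → ℕ}

/-- The set `N_α` of all `β = (β_1, …, β_ℓ) ∈ ℕ₀^{n_1} × ⋯ × ℕ₀^{n_ℓ}` with `|β_j| ≤ α_j` for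
all `j`. -/
def N (α : Fin ℓ → ℕ∞) : Set ((Σ j, Fin (n j)) → ℕ) :=
  {β | ∀ j, ((∑ i, β ⟨j, i⟩ : ℕ) : ℕ∞) ≤ α j}

/-- `f : U → E` is `C^α`, where `α ∈ (ℕ₀ ∪ {∞})^ℓ`: it is `C^β` for all `β ∈ N_α`. -/
def IsBlockC (U : Set ((Σ j, Fin (n j)) → K)) (α : Fin ℓ → ℕ∞) (f : U → E) : Prop :=
  ∀ β ∈ N (n := n) α, IsC U (fun i => (β i : ℕ∞)) f

/-- The space `C^α(U, E)` for `α ∈ (ℕ₀ ∪ {∞})^ℓ`. -/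
structure BlockCSpace (U : Set ((Σ j, Fin (n j)) → K)) (E : Type*) [AddCommGroup E] [Module K E]
    [TopologicalSpace E] (α : Fin ℓ → ℕ∞) where
  toFun : U → E
  isBlockC : IsBlockC U α toFun

/-- The inclusion map `C^α(U, E) → C^β(U, E)` for `β ∈ N_α`. -/
def incl {U : Set ((Σ j, Fin (n j)) → K)} {α : Fin ℓ → ℕ∞} {β : (Σ j, Fin (n j)) → ℕ}
    (hβ : β ∈ N α) (f : BlockCSpace U E α) : CSpace U E (fun i => (β i : ℕ∞)) :=
  ⟨f.toFun, f.isBlockC β hβ⟩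

/-- The compact-open `C^α`-topology: the initial topology with respect to the inclusion maps into
the spaces `C^β(U, E)` with `β ∈ N_α`. -/
instance (U : Set ((Σ j, Fin (n j)) → K)) (α : Fin ℓ → ℕ∞) :
    TopologicalSpace (BlockCSpace U E α) :=
  ⨅ (β : (Σ j, Fin (n j)) → ℕ) (hβ : β ∈ N α), TopologicalSpace.induced (incl hβ) inferInstance

/-- `p` agrees on `V` with a polynomial function of multidegree `≤ α`, that is, with a finite sum
`∑ x^β a_β` over multi-indices `β ∈ N_α`, where `a_β ∈ E`. -/
def IsPolyOn {U : Set ((Σ j, Fin (n j)) → K)} (α : Fin ℓ → ℕ∞) (p : U → E) (V : Set U) : Prop :=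
  ∃ a : ((Σ j, Fin (n j)) → ℕ) →₀ E, (∀ β, a β ≠ 0 → β ∈ N α) ∧
    ∀ x ∈ V, p x = a.sum fun β c => (∏ i, x.1 i ^ β i) • c

/-- The set of all locally polynomial functions `U → E` of multidegree `≤ α`. -/
def LocPol (U : Set ((Σ j, Fin (n j)) → K)) (E : Type*) [AddCommGroup E] [Module K E]
    (α : Fin ℓ → ℕ∞) : Set (U → E) :=
  {f | ∀ x : U, ∃ V : Set U, IsOpen V ∧ x ∈ V ∧ IsPolyOn α f V}

end Blocks

end CAlpha

end

/-! The approximants are Newton interpolation polynomials on small cells, built one block of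
variables after another. The working tool is the divided difference `divDiff F s` at finite node
sets `s i`; it has order γ when `s i` has γ i + 1 elements.

By the recursion `sub_smul_divDiff`, nodes with different limits can be separated, so only the
confluence of all nodes at one point matters: being C^α means that the divided differences of orders
in N_α converge as the nodes shrink to a point of U (`isBlockC_iff_hasDiagLim`). This condition is
local and stable under sums, multiplication by coordinates and freezing of variables. Hence locally
polynomial functions and cellwise interpolants are C^α.

A neighbourhood in C^α(U, E) imposes finitely many conditions of the form `SmallOn`, so α may be
replaced by finite bounds r j. Fix a block J with bound r, and interpolate F in the variables of J,
in total degree ≤ r, on cells of radius ‖δ‖. A divided difference of the interpolant of total order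
r in J is one of F at other nodes of the same cell; by uniform continuity near a compact set the
error then lies in a given open 𝕆-submodule W. Exchanging nodes for interpolation nodes shows that
each degree by which the order falls below r gains a factor δ
(`inv_pow_smul_divDiff_sub_newton_mem`). Conversely, nodes in different cells are at distance > ‖δ‖,
so reducing to nodes in one cell costs at most a factor δ⁻¹ per removed node
(`inv_smul_divDiff_mem_of_forall_cell`). As the order in J is at most r, the gain covers the loss.
The loss in the other variables involves only radii fixed earlier and is absorbed into W before δ is
chosen (`exists_smallOn_sub_cellNewton`).

Interpolation in a new block takes values of F at nodes of the same cell only, so it keeps the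
polynomial dependence on the blocks already treated (`newton_mem_polySpan`). After the last block
the function is locally polynomial. -/

noncomputable section

namespace CAlpha

open scoped Classical

/-! ### Algebra of divided differences -/

section Algebra

variable {ι K E : Type*} [Fintype ι] [Field K] [AddCommGroup E] [Module K E]

/-- The coefficient of `f u` in the divided difference of `f` at the points of `s`. -/
def weight (s : Finset K) (u : K) : K :=
  if u ∈ s then ∏ y ∈ s.erase u, (u - y)⁻¹ else 0

/-- The multivariate divided difference of `F` at the finite sets of nodes `s i`. -/
def divDiff (F : (ι → K) → E) (s : ι → Finset K) : E :=
  ∑ x ∈ Fintype.piFinset s, (∏ i, weight (s i) (x i)) • F x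

theorem weight_of_notMem {s : Finset K} {u : K} (h : u ∉ s) : weight s u = 0 := if_neg h

theorem weight_singleton (x u : K) : weight {x} u = if u = x then 1 else 0 := by
  unfold weight
  by_cases h : u = x
  · subst h; simp
  · simp [h]

/-- The factor u - x cancels the factor of the node x in the weight, and vanishes at u = x. All the
recursions below come from this identity. -/
theorem weight_erase {s : Finset K} {x : K} (hx : x ∈ s) (u : K) :
    weight (s.erase x) u = (u - x) * weight s u := by
  unfold weight
  by_cases hu : u = x
  · subst hu; simp
  by_cases hs : u ∈ s
  · rw [if_pos (Finset.mem_erase.2 ⟨hu, hs⟩), if_pos hs,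
      ← Finset.mul_prod_erase (s.erase u) _ (Finset.mem_erase.2 ⟨Ne.symm hu, hx⟩),
      Finset.erase_right_comm, mul_inv_cancel_left₀ (sub_ne_zero.2 hu)]
  · simp [hs]

theorem divDiff_eq_sum_of_subset (F : (ι → K) → E) {s A : ι → Finset K} (h : ∀ i, s i ⊆ A i) :
    divDiff F s = ∑ x ∈ Fintype.piFinset A, (∏ i, weight (s i) (x i)) • F x := by
  refine Finset.sum_subset (Fintype.piFinset_subset _ _ h) fun x _ hx => ?_
  obtain ⟨i, hi⟩ : ∃ i, x i ∉ s i := by simpa using hx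
  rw [Finset.prod_eq_zero (Finset.mem_univ i) (weight_of_notMem hi), zero_smul]

theorem divDiff_congr {F G : (ι → K) → E} {s : ι → Finset K}
    (h : ∀ x ∈ Fintype.piFinset s, F x = G x) : divDiff F s = divDiff G s :=
  Finset.sum_congr rfl fun x hx => by rw [h x hx]

theorem divDiff_singleton (F : (ι → K) → E) (x : ι → K) : divDiff F (fun i => {x i}) = F x := by
  unfold divDiff
  rw [Fintype.piFinset_singleton, Finset.sum_singleton]
  simp [weight_singleton]

theorem divDiff_add (F G : (ι → K) → E) (s : ι → Finset K) :
    divDiff (fun x => F x + G x) s = divDiff F s + divDiff G s := by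
  simp [divDiff, Finset.sum_add_distrib]

theorem divDiff_sub (F G : (ι → K) → E) (s : ι → Finset K) :
    divDiff (fun x => F x - G x) s = divDiff F s - divDiff G s := by
  simp [divDiff, Finset.sum_sub_distrib, smul_sub]

theorem divDiff_smul (c : K) (F : (ι → K) → E) (s : ι → Finset K) :
    divDiff (fun x => c • F x) s = c • divDiff F s := by
  simp [divDiff, Finset.smul_sum, smul_comm c]

theorem divDiff_sum {σ : Type*} (T : Finset σ) (F : σ → (ι → K) → E) (s : ι → Finset K) :
    divDiff (fun x => ∑ k ∈ T, F k x) s = ∑ k ∈ T, divDiff (F k) s := by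
  simp only [divDiff, Finset.smul_sum]
  exact Finset.sum_comm

theorem divDiff_update_erase (F : (ι → K) → E) (s : ι → Finset K) (i : ι) {x : K}
    (hx : x ∈ s i) :
    divDiff F (Function.update s i ((s i).erase x)) =
      divDiff (fun z => (z i - x) • F z) s := by
  rw [divDiff_eq_sum_of_subset (A := s)]
  · refine Finset.sum_congr rfl fun z _ => ?_
    rw [smul_smul, ← Finset.mul_prod_erase _ _ (Finset.mem_univ i),
      ← Finset.mul_prod_erase _ (fun k => weight (s k) (z k)) (Finset.mem_univ i),
      Function.update_self, weight_erase hx]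
    congr 1
    rw [mul_right_comm, mul_comm]
    rw [mul_comm, Finset.prod_congr rfl fun k hk => by
      rw [Function.update_of_ne (Finset.ne_of_mem_erase hk)]]
    ring
  · intro k
    by_cases h : k = i
    · subst h; simpa using Finset.erase_subset _ _
    · simp [h]

/-- Leibniz rule for a linear factor: write z i - c = (x - c) + (z i - x); the second summand erases
the node x. -/
theorem divDiff_coord_smul (F : (ι → K) → E) (s : ι → Finset K) (i : ι) (c : K) {x : K}
    (hx : x ∈ s i) :
    divDiff (fun z => (z i - c) • F z) s =
      (x - c) • divDiff F s + divDiff F (Function.update s i ((s i).erase x)) := by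
  rw [divDiff_update_erase F s i hx, ← divDiff_smul, ← divDiff_add]
  congr 1
  ext z
  rw [← add_smul]
  congr 1
  ring

/-- The recursion formula for divided differences. -/
theorem sub_smul_divDiff (F : (ι → K) → E) (s : ι → Finset K) (i : ι) {x y : K}
    (hx : x ∈ s i) (hy : y ∈ s i) :
    (x - y) • divDiff F s = divDiff F (Function.update s i ((s i).erase y)) -
      divDiff F (Function.update s i ((s i).erase x)) := by
  rw [divDiff_update_erase F s i hx, divDiff_update_erase F s i hy, ← divDiff_smul,
    ← divDiff_sub]
  congr 1
  ext z
  rw [← sub_smul]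
  congr 1
  ring

/-- The univariate divided difference of `φ`. -/
def divDiffOne (φ : K → K) (t : Finset K) : K := ∑ u ∈ t, weight t u * φ u

theorem sum_weight_mul_eq {φ : K → K} {s A : Finset K} (h : s ⊆ A) :
    ∑ u ∈ A, weight s u * φ u = divDiffOne φ s :=
  (Finset.sum_subset h fun u _ hu => by rw [weight_of_notMem hu, zero_mul]).symm

theorem divDiffOne_erase (φ : K → K) {t : Finset K} {x : K} (hx : x ∈ t) :
    divDiffOne φ (t.erase x) = divDiffOne (fun u => (u - x) * φ u) t := by
  rw [← sum_weight_mul_eq (Finset.erase_subset x t)]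
  exact Finset.sum_congr rfl fun u _ => by rw [weight_erase hx]; ring

theorem divDiffOne_sub_mul (φ : K → K) {t : Finset K} {x : K} (hx : x ∈ t) (c : K) :
    divDiffOne (fun u => (u - c) * φ u) t =
      (x - c) * divDiffOne φ t + divDiffOne φ (t.erase x) := by
  rw [divDiffOne_erase φ hx]
  simp only [divDiffOne, Finset.mul_sum, ← Finset.sum_add_distrib]
  exact Finset.sum_congr rfl fun u _ => by ring

theorem divDiffOne_one_of_card_eq_one {t : Finset K} (h : t.card = 1) :
    divDiffOne (fun _ => 1) t = 1 := by
  obtain ⟨x, rfl⟩ := Finset.card_eq_one.1 h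
  simp [divDiffOne, weight_singleton]

theorem divDiffOne_one_of_one_lt_card {t : Finset K} (h : 1 < t.card) :
    divDiffOne (fun _ => 1) t = 0 := by
  induction hn : t.card using Nat.strong_induction_on generalizing t with
  | _ n ih =>
    obtain ⟨x, hx, y, hy, hxy⟩ := Finset.one_lt_card.1 h
    have key : (x - y) * divDiffOne (fun _ => 1) t =
        divDiffOne (fun _ => 1) (t.erase y) - divDiffOne (fun _ => 1) (t.erase x) := by
      rw [divDiffOne_erase _ hx, divDiffOne_erase _ hy]
      simp only [divDiffOne, Finset.mul_sum, ← Finset.sum_sub_distrib]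
      exact Finset.sum_congr rfl fun u _ => by ring
    have hcx := Finset.card_erase_of_mem hx
    have hcy := Finset.card_erase_of_mem hy
    refine (mul_eq_zero.1 ?_).resolve_left (sub_ne_zero.2 hxy)
    rw [key]
    by_cases h2 : n = 2
    · rw [divDiffOne_one_of_card_eq_one (by omega), divDiffOne_one_of_card_eq_one (by omega),
        sub_self]
    · rw [ih (n - 1) (by omega) (t := t.erase y) (by omega) (by omega),
        ih (n - 1) (by omega) (t := t.erase x) (by omega) (by omega), sub_self]

/-- A divided difference at m + 1 nodes reads off the leading coefficient of a monic polynomial of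
degree m, and more nodes annihilate it. -/
theorem divDiffOne_newton_of_lt_card (a : ℕ → K) (m : ℕ) {t : Finset K} (h : m + 1 ≤ t.card) :
    divDiffOne (fun u => ∏ k ∈ Finset.range m, (u - a k)) t =
      if t.card = m + 1 then 1 else 0 := by
  induction m generalizing t with
  | zero =>
    simp only [Finset.range_zero, Finset.prod_empty, zero_add]
    split_ifs with h1
    · exact divDiffOne_one_of_card_eq_one h1
    · exact divDiffOne_one_of_one_lt_card (by omega)
  | succ m ih =>
    obtain ⟨x, hx⟩ := Finset.card_pos.1 (by omega : 0 < t.card)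
    have hc := Finset.card_erase_of_mem hx
    have hf : (fun u => ∏ k ∈ Finset.range (m + 1), (u - a k)) =
        fun u => (u - a m) * ∏ k ∈ Finset.range m, (u - a k) := by
      ext u; rw [Finset.prod_range_succ, mul_comm]
    rw [hf, divDiffOne_sub_mul _ hx, ih (by omega), ih (by omega), hc, if_neg (by omega)]
    simp only [mul_zero, zero_add]
    congr 1
    simp only [eq_iff_iff]
    omega

/-- The Newton polynomial of degree m vanishes at each of its first m nodes, hence at the p + 1 ≤ m
nodes used here. -/
theorem divDiffOne_newton_of_card_le (a : ℕ → K) {m p : ℕ} (h : p < m) :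
    divDiffOne (fun u => ∏ k ∈ Finset.range m, (u - a k)) ((Finset.range (p + 1)).image a) =
      0 := by
  refine Finset.sum_eq_zero fun u hu => ?_
  obtain ⟨k, hk, rfl⟩ := Finset.mem_image.1 hu
  have h0 : ∏ j ∈ Finset.range m, (a k - a j) = 0 :=
    Finset.prod_eq_zero (Finset.mem_range.2 (by rw [Finset.mem_range] at hk; omega)) (sub_self _)
  simp only [h0, mul_zero]

/-- Fubini's theorem for divided differences: the coordinates in `J` are integrated out against
the factors `φ i` and replaced by the divided difference at `A i`. -/
theorem divDiff_prod_smul_piecewise (J : Finset ι) (φ : ι → K → K) (A t : ι → Finset K)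
    (F : (ι → K) → E) :
    divDiff (fun x => (∏ i ∈ J, φ i (x i)) • divDiff F (J.piecewise A fun i => {x i})) t =
      (∏ i ∈ J, divDiffOne (φ i) (t i)) • divDiff F (J.piecewise A t) := by
  have hprod : ∀ g : ι → K, ∏ i ∈ J, g i = ∏ i, if i ∈ J then g i else 1 := fun g => by
    rw [Finset.prod_ite_mem, Finset.univ_inter]
  have h1 : ∀ x ∈ Fintype.piFinset t,
      (∏ i, weight (t i) (x i)) • (∏ i ∈ J, φ i (x i)) •
        divDiff F (J.piecewise A fun i => {x i}) =
      ∑ q ∈ Fintype.piFinset (fun i => A i ∪ t i),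
        (∏ i, weight (t i) (x i) * ((if i ∈ J then φ i (x i) else 1) *
          weight (J.piecewise A (fun i => {x i}) i) (q i))) • F q := by
    intro x hx
    rw [divDiff_eq_sum_of_subset (A := fun i => A i ∪ t i), Finset.smul_sum, Finset.smul_sum]
    · refine Finset.sum_congr rfl fun q _ => ?_
      rw [smul_smul, smul_smul, hprod, Finset.prod_mul_distrib, Finset.prod_mul_distrib, mul_assoc]
    · intro i
      have := Fintype.mem_piFinset.1 hx i
      by_cases hi : i ∈ J
      · simp [hi]
      · simp [hi, this]
  unfold divDiff at h1 ⊢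
  rw [Finset.sum_congr rfl h1, Finset.sum_comm]
  have h2 := divDiff_eq_sum_of_subset F (s := J.piecewise A t) (A := fun i => A i ∪ t i)
    (fun i => by by_cases hi : i ∈ J <;> simp [hi])
  unfold divDiff at h2
  rw [h2, Finset.smul_sum]
  refine Finset.sum_congr rfl fun q _ => ?_
  rw [smul_smul, ← Finset.sum_smul, hprod, ← Finset.prod_mul_distrib]
  congr 1
  -- Both sides are now compared coefficientwise at F q; the inner sum over x factors into
  -- one-variable sums.
  have h3 := Finset.prod_univ_sum t (fun i u => weight (t i) u * ((if i ∈ J then φ i u else 1) *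
          weight (if i ∈ J then A i else {u}) (q i)))
  simp only [Finset.piecewise]
  rw [← h3]
  refine Finset.prod_congr rfl fun i _ => ?_
  by_cases hi : i ∈ J
  · simp [hi, divDiffOne, Finset.sum_mul, mul_assoc]
  · simp only [hi, if_false, one_mul, weight_singleton]
    by_cases hq : q i ∈ t i
    · simp [hq]
    · simp [hq, weight_of_notMem hq]

end Algebra

theorem exists_lt_of_sum_le {ι : Type*} {J : Finset ι} {m p : ι → ℕ}
    (h : ∑ i ∈ J, m i ≤ ∑ i ∈ J, p i)
    (hne : ∃ i ∈ J, m i ≠ p i) : ∃ i ∈ J, m i < p i := by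
  by_contra! hc
  obtain ⟨i, hi, hmp⟩ := hne
  have := Finset.sum_lt_sum hc ⟨i, hi, lt_of_le_of_ne (hc i hi) (Ne.symm hmp)⟩
  omega

/-! ### Newton interpolation in a subset of the variables -/

section Newton

variable {ι K E : Type*} [Fintype ι] [Field K] [AddCommGroup E] [Module K E]

/-- The multi-indices supported in `J` of total degree at most `r`. -/
def degreesLE (J : Finset ι) (r : ℕ) : Finset (ι → ℕ) :=
  (Fintype.piFinset fun i => if i ∈ J then Finset.range (r + 1) else {0}).filter
    fun m => ∑ i ∈ J, m i ≤ r

theorem mem_degreesLE {J : Finset ι} {r : ℕ} {m : ι → ℕ} :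
    m ∈ degreesLE J r ↔ (∀ i ∉ J, m i = 0) ∧ ∑ i ∈ J, m i ≤ r := by
  simp only [degreesLE, Finset.mem_filter, Fintype.mem_piFinset]
  refine and_congr_left fun h => ⟨fun hm i hi => by simpa [hi] using hm i, fun hm i => ?_⟩
  by_cases hi : i ∈ J
  · have := Finset.single_le_sum (fun _ _ => Nat.zero_le _) hi (f := m)
    simp only [hi, if_true, Finset.mem_range]
    omega
  · simp [hi, hm i hi]

/-- The first `m i` nodes of the sequence `a i`, for each `i`. -/
def initNodes (a : ι → ℕ → K) (m : ι → ℕ) (i : ι) : Finset K := (Finset.range (m i)).image (a i)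

/-- The Newton interpolation polynomial of total degree `≤ r` in the variables in `J`. -/
def newton (J : Finset ι) (r : ℕ) (a : ι → ℕ → K) (F : (ι → K) → E) (x : ι → K) : E :=
  ∑ m ∈ degreesLE J r, (∏ i ∈ J, ∏ k ∈ Finset.range (m i), (x i - a i k)) •
    divDiff F (J.piecewise (initNodes a (m + 1)) fun i => {x i})

theorem divDiff_newton (J : Finset ι) (r : ℕ) (a : ι → ℕ → K) (F : (ι → K) → E)
    (t : ι → Finset K) :
    divDiff (newton J r a F) t = ∑ m ∈ degreesLE J r,
      (∏ i ∈ J, divDiffOne (fun u => ∏ k ∈ Finset.range (m i), (u - a i k)) (t i)) •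
        divDiff F (J.piecewise (initNodes a (m + 1)) t) := by
  unfold newton
  rw [divDiff_sum]
  exact Finset.sum_congr rfl fun m _ => divDiff_prod_smul_piecewise J
    (fun i u => ∏ k ∈ Finset.range (m i), (u - a i k)) _ t F

/-- By Fubini every summand carries a product of one-variable divided differences of Newton
polynomials. If all other summands have a zero factor, only the one with m i + 1 = |t i| on J
survives, and its product is 1. -/
theorem divDiff_newton_eq_single {J : Finset ι} {r : ℕ} (a : ι → ℕ → K) (F : (ι → K) → E)
    {t : ι → Finset K} (ht : ∀ i ∈ J, (t i).Nonempty) (hr : ∑ i ∈ J, ((t i).card - 1) ≤ r)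
    (h0 : ∀ m ∈ degreesLE J r, (∃ i ∈ J, m i ≠ (t i).card - 1) →
      ∃ i ∈ J, divDiffOne (fun u => ∏ k ∈ Finset.range (m i), (u - a i k)) (t i) = 0) :
    divDiff (newton J r a F) t =
      divDiff F (J.piecewise (initNodes a fun i => (t i).card) t) := by
  set p : ι → ℕ := fun i => if i ∈ J then (t i).card - 1 else 0 with hp
  have hpJ : ∀ i ∈ J, p i + 1 = (t i).card := fun i hi => by
    have := Finset.card_pos.2 (ht i hi)
    simp only [hp, hi, if_true]
    omega
  have hpm : p ∈ degreesLE J r := by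
    refine mem_degreesLE.2 ⟨fun i hi => by simp [hp, hi], ?_⟩
    refine le_of_eq_of_le (Finset.sum_congr rfl fun i hi => ?_) hr
    simp only [hp, hi, if_true]
  rw [divDiff_newton, Finset.sum_eq_single_of_mem p hpm]
  · rw [Finset.prod_eq_one, one_smul]
    · congr 1
      funext i
      by_cases hi : i ∈ J
      · simp only [hi, Finset.piecewise_eq_of_mem, initNodes, Pi.add_apply, Pi.one_apply]
        rw [hpJ i hi]
      · simp only [hi, not_false_eq_true, Finset.piecewise_eq_of_notMem]
    · intro i hi
      rw [divDiffOne_newton_of_lt_card _ _ (hpJ i hi).le, if_pos (hpJ i hi).symm]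
  · intro m hm hmp
    have hex : ∃ i ∈ J, m i ≠ (t i).card - 1 := by
      by_contra! hc
      refine hmp (funext fun i => ?_)
      by_cases hi : i ∈ J
      · rw [hc i hi]; simp [hp, hi]
      · rw [(mem_degreesLE.1 hm).1 i hi]; simp [hp, hi]
    obtain ⟨i, hi, h⟩ := h0 m hm hex
    rw [Finset.prod_eq_zero hi h, zero_smul]

/-- At top order r, any other multi-index of total degree ≤ r is too small in some coordinate, where
the Newton polynomial is annihilated for degree reasons. -/
theorem divDiff_newton_of_sum_eq {J : Finset ι} {r : ℕ} (a : ι → ℕ → K) (F : (ι → K) → E)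
    {t : ι → Finset K} (ht : ∀ i ∈ J, (t i).Nonempty) (hr : ∑ i ∈ J, ((t i).card - 1) = r) :
    divDiff (newton J r a F) t =
      divDiff F (J.piecewise (initNodes a fun i => (t i).card) t) := by
  refine divDiff_newton_eq_single a F ht hr.le fun m hm hex => ?_
  obtain ⟨i, hi, hlt⟩ := exists_lt_of_sum_le ((mem_degreesLE.1 hm).2.trans hr.ge) hex
  exact ⟨i, hi, by rw [divDiffOne_newton_of_lt_card _ _ (by omega), if_neg (by omega)]⟩

/-- The interpolation property: a degree that is too small is annihilated by the divided difference,
and one that is too large gives a polynomial vanishing at all the nodes. -/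
theorem divDiff_newton_of_eq_initNodes {J : Finset ι} {r : ℕ} {a : ι → ℕ → K}
    (F : (ι → K) → E) {t : ι → Finset K} (ht : ∀ i ∈ J, (t i).Nonempty)
    (hr : ∑ i ∈ J, ((t i).card - 1) ≤ r)
    (hta : ∀ i ∈ J, t i = (Finset.range (t i).card).image (a i)) :
    divDiff (newton J r a F) t = divDiff F t := by
  rw [divDiff_newton_eq_single a F ht hr]
  · congr 1
    funext i
    by_cases hi : i ∈ J
    · simp only [hi, Finset.piecewise_eq_of_mem]
      exact (hta i hi).symm
    · simp only [hi, not_false_eq_true, Finset.piecewise_eq_of_notMem]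
  · rintro m hm ⟨i, hi, hne⟩
    refine ⟨i, hi, ?_⟩
    have hc := Finset.card_pos.2 (ht i hi)
    rcases hne.lt_or_gt with h | h
    · rw [divDiffOne_newton_of_lt_card _ _ (by omega), if_neg (by omega)]
    · rw [hta i hi, show (t i).card = (t i).card - 1 + 1 by omega]
      exact divDiffOne_newton_of_card_le _ h

end Newton

/-! ### Error estimate within a cell, and passage between cells -/

section Estimates

variable {ι K E : Type*} [Fintype ι] [NormedField K] [AddCommGroup E] [Module K E]

/-- Error estimate for Newton interpolation in the variables in `J`. -/
theorem inv_pow_smul_divDiff_sub_newton_mem {J : Finset ι} {r : ℕ} {a : ι → ℕ → K}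
    {F : (ι → K) → E} {W : AddSubgroup E} (hW : ∀ c : K, ‖c‖ ≤ 1 → ∀ w ∈ W, c • w ∈ W)
    {d : K} (hd : d ≠ 0) {B : ι → Set K}
    (hB : ∀ i ∈ J, ∀ x ∈ B i, ∀ y ∈ B i, ‖x - y‖ ≤ ‖d‖)
    (ha : ∀ i ∈ J, Function.Injective (a i)) (haB : ∀ i ∈ J, ∀ k, a i k ∈ B i)
    {T : ι → Finset K}
    (H : ∀ t t' : ι → Finset K, (∀ i ∉ J, t i = T i ∧ t' i = T i) →
      (∀ i ∈ J, (t i : Set K) ⊆ B i ∧ (t' i : Set K) ⊆ B i ∧ (t i).card = (t' i).card ∧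
        (t i).Nonempty) → ∑ i ∈ J, ((t i).card - 1) = r → divDiff F t - divDiff F t' ∈ W)
    (k : ℕ) : ∀ t : ι → Finset K, (∀ i ∉ J, t i = T i) →
      (∀ i ∈ J, (t i : Set K) ⊆ B i ∧ (t i).Nonempty) → ∑ i ∈ J, ((t i).card - 1) + k = r →
      (d ^ k)⁻¹ • divDiff (fun x => F x - newton J r a F x) t ∈ W := by
  induction k with
  | zero =>
    intro t hT hJ hr
    rw [pow_zero, inv_one, one_smul, divDiff_sub,
      divDiff_newton_of_sum_eq a F (fun i hi => (hJ i hi).2) (by omega)]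
    refine H _ _ (fun i hi => ⟨hT i hi, by simp [hi, hT i hi]⟩) (fun i hi => ⟨(hJ i hi).1, ?_, ?_,
      (hJ i hi).2⟩) (by omega)
    · simp only [hi, Finset.piecewise_eq_of_mem, initNodes, Finset.coe_image]
      rintro _ ⟨k, -, rfl⟩
      exact haB i hi k
    · simp [hi, initNodes, Finset.card_image_of_injective _ (ha i hi)]
  | succ k ih =>
    intro t hT hJ hr
    -- Inner induction on the number of nodes that are not among the first interpolation nodes. If
    -- there are none, the error has divided difference zero.
    induction hN : ∑ i ∈ J, (t i \ (Finset.range (t i).card).image (a i)).card using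
      Nat.strong_induction_on generalizing t with
    | _ N ihN =>
      by_cases hall : ∀ i ∈ J, t i ⊆ (Finset.range (t i).card).image (a i)
      · rw [divDiff_sub, divDiff_newton_of_eq_initNodes F (fun i hi => (hJ i hi).2) (by omega)
          fun i hi => ?_, sub_self, smul_zero]
        · exact W.zero_mem
        · refine Finset.eq_of_subset_of_card_le (hall i hi) ?_
          rw [Finset.card_image_of_injective _ (ha i hi), Finset.card_range]
      push Not at hall
      obtain ⟨i, hi, hnot⟩ := hall
      set A := (Finset.range (t i).card).image (a i) with hA
      have hAc : A.card = (t i).card := by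
        rw [hA, Finset.card_image_of_injective _ (ha i hi), Finset.card_range]
      obtain ⟨x, hx, hxA⟩ := Finset.not_subset.1 hnot
      obtain ⟨y, hyA, hy⟩ : ∃ y ∈ A, y ∉ t i := by
        by_contra! hc
        exact hxA ((Finset.eq_of_subset_of_card_le hc hAc.ge).symm ▸ hx)
      have hxy : x ≠ y := fun h => hy (h ▸ hx)
      have hyB : y ∈ B i := by
        obtain ⟨l, -, rfl⟩ := Finset.mem_image.1 hyA
        exact haB i hi l
      have hxB : x ∈ B i := (hJ i hi).1 hx
      -- Exchange x for an unused interpolation node y. The recursion gives [t] = (x - y)[u] + [t']: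
      -- u has one order more, so the outer induction applies, and t' has fewer foreign nodes.
      set u := Function.update t i (insert y (t i)) with hu
      set t' := Function.update t i (insert y ((t i).erase x)) with ht'
      have hcard' : (insert y ((t i).erase x)).card = (t i).card := by
        rw [Finset.card_insert_of_notMem (fun h => hy (Finset.mem_of_mem_erase h)),
          Finset.card_erase_of_mem hx]
        have := Finset.card_pos.2 (hJ i hi).2
        omega
      have hc' : ∀ j, (t' j).card = (t j).card := fun j => by
        by_cases h : j = i
        · subst h; rw [ht', Function.update_self, hcard']
        · rw [ht', Function.update_of_ne h]
      have hrec := sub_smul_divDiff (fun x => F x - newton J r a F x) u i (x := x) (y := y)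
        (by simp [hu, hx]) (by simp [hu])
      have e1 : Function.update u i ((u i).erase y) = t := by
        rw [hu, Function.update_idem, Function.update_self, Finset.erase_insert hy,
          Function.update_eq_self]
      have e2 : Function.update u i ((u i).erase x) = t' := by
        rw [hu, Function.update_idem, Function.update_self,
          Finset.erase_insert_of_ne (Ne.symm hxy)]
      rw [e1, e2] at hrec
      have hne : ∀ j ∉ J, j ≠ i := fun j hj h => hj (h ▸ hi)
      have m1 : (d ^ (k + 1))⁻¹ • divDiff (fun x => F x - newton J r a F x) t' ∈ W := by
        refine ihN _ ?_ t' (fun j hj => ?_) (fun j hj => ?_) ?_ rfl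
        · rw [← hN]
          refine Finset.sum_lt_sum (fun j hj => ?_) ⟨i, hi, ?_⟩
          · rw [hc' j]
            by_cases h : j = i
            · subst h
              refine Finset.card_le_card fun z hz => ?_
              simp only [ht', Function.update_self, Finset.mem_sdiff, Finset.mem_insert,
                Finset.mem_erase] at hz ⊢
              rcases hz with ⟨rfl | hz, hz2⟩
              · exact absurd hyA hz2
              · exact ⟨hz.2, hz2⟩
            · rw [ht', Function.update_of_ne h]
          · rw [hc' i]
            refine Finset.card_lt_card (Finset.ssubset_iff_of_subset ?_ |>.2 ⟨x, ?_, ?_⟩)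
            · intro z hz
              simp only [ht', Function.update_self, Finset.mem_sdiff, Finset.mem_insert,
                Finset.mem_erase] at hz ⊢
              rcases hz with ⟨rfl | hz, hz2⟩
              · exact absurd hyA hz2
              · exact ⟨hz.2, hz2⟩
            · exact Finset.mem_sdiff.2 ⟨hx, hxA⟩
            · simp [ht', hxy]
        · rw [ht', Function.update_of_ne (hne j hj), hT j hj]
        · by_cases h : j = i
          · subst h
            rw [ht', Function.update_self]
            refine ⟨fun z hz => ?_, Finset.insert_nonempty _ _⟩
            rcases Finset.mem_insert.1 (Finset.mem_coe.1 hz) with rfl | hz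
            · exact hyB
            · exact (hJ j hj).1 (Finset.mem_of_mem_erase hz)
          · rw [ht', Function.update_of_ne h]
            exact hJ j hj
        · simp only [hc']
          exact hr
      have m2 : (d ^ k)⁻¹ • divDiff (fun x => F x - newton J r a F x) u ∈ W := by
        refine ih u (fun j hj => ?_) (fun j hj => ?_) ?_
        · rw [hu, Function.update_of_ne (hne j hj), hT j hj]
        · by_cases h : j = i
          · subst h
            rw [hu, Function.update_self]
            refine ⟨fun z hz => ?_, Finset.insert_nonempty _ _⟩
            rcases Finset.mem_insert.1 (Finset.mem_coe.1 hz) with rfl | hz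
            · exact hyB
            · exact (hJ j hj).1 hz
          · rw [hu, Function.update_of_ne h]
            exact hJ j hj
        · rw [← hr, ← Finset.add_sum_erase J _ hi, ← Finset.add_sum_erase J _ hi]
          rw [Finset.sum_congr rfl fun j hj => by
            rw [hu, Function.update_of_ne (Finset.ne_of_mem_erase hj)], hu, Function.update_self,
            Finset.card_insert_of_notMem hy]
          have := Finset.card_pos.2 (hJ i hi).2
          omega
      have e3 : (d ^ (k + 1))⁻¹ • divDiff (fun x => F x - newton J r a F x) t =
          ((x - y) / d) • (d ^ k)⁻¹ • divDiff (fun x => F x - newton J r a F x) u +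
          (d ^ (k + 1))⁻¹ • divDiff (fun x => F x - newton J r a F x) t' := by
        rw [eq_sub_iff_add_eq] at hrec
        rw [← hrec, smul_add, smul_smul, smul_smul]
        congr 2
        rw [pow_succ]
        field_simp
      rw [e3]
      refine W.add_mem (hW _ ?_ _ m2) m1
      rw [norm_div]
      exact div_le_one_of_le₀ (hB i hi x hxB y hyB) (norm_nonneg _)

/-- A divided difference is controlled by the divided differences at those subsets of the nodes
which are contained in a single cell. -/
theorem inv_smul_divDiff_mem_of_forall_cell {F : (ι → K) → E} {W : AddSubgroup E}
    (hW : ∀ c : K, ‖c‖ ≤ 1 → ∀ w ∈ W, c • w ∈ W) {d : ι → K} (hd : ∀ i, d i ≠ 0)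
    (s : ι → Finset K) (hs : ∀ i, (s i).Nonempty) (e : K)
    (h : ∀ t : ι → Finset K, (∀ i, t i ⊆ s i ∧ (t i).Nonempty) →
      (∀ i, ∀ x ∈ t i, ∀ y ∈ t i, ‖x - y‖ ≤ ‖d i‖) →
      (e * ∏ i, d i ^ ((s i).card - (t i).card))⁻¹ • divDiff F t ∈ W) :
    e⁻¹ • divDiff F s ∈ W := by
  induction hN : ∑ i, (s i).card using Nat.strong_induction_on generalizing s e with
  | _ N ih =>
    by_cases hall : ∀ i, ∀ x ∈ s i, ∀ y ∈ s i, ‖x - y‖ ≤ ‖d i‖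
    · simpa using h s (fun i => ⟨Finset.Subset.refl _, hs i⟩) hall
    push Not at hall
    obtain ⟨i, x, hx, y, hy, hlt⟩ := hall
    have hxy : x ≠ y := fun h => by
      rw [h, sub_self, norm_zero] at hlt
      exact absurd hlt (norm_nonneg _).not_gt
    -- Erasing one node in direction i accounts for one factor d i, which is moved into the scalar e
    -- of the induction hypothesis.
    have key : ∀ z ∈ s i, ∀ z' ∈ s i, z ≠ z' →
        (e * d i)⁻¹ • divDiff F (Function.update s i ((s i).erase z)) ∈ W := by
      intro z hz z' hz' hzz
      have hc := Finset.card_erase_of_mem hz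
      have hpos := Finset.card_pos.2 (hs i)
      refine ih _ ?_ _ (fun j => ?_) _ (fun t ht ht' => ?_) rfl
      · rw [← hN]
        refine Finset.sum_lt_sum (fun j _ => ?_) ⟨i, Finset.mem_univ i, ?_⟩
        · by_cases hj : j = i
          · subst hj; simpa using Finset.card_erase_le
          · simp [hj]
        · rw [Function.update_self]; omega
      · by_cases hj : j = i
        · subst hj
          rw [Function.update_self]
          exact ⟨z', Finset.mem_erase.2 ⟨hzz.symm, hz'⟩⟩
        · simpa [hj] using hs j
      · have hti := (ht i).1
        rw [Function.update_self] at hti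
        have hcard := Finset.card_le_card hti
        have := h t (fun j => ⟨?_, (ht j).2⟩) ht'
        · convert this using 3
          rw [mul_assoc]
          congr 1
          rw [← Finset.mul_prod_erase _ _ (Finset.mem_univ i),
            ← Finset.mul_prod_erase _ (fun i => d i ^ ((s i).card - (t i).card))
              (Finset.mem_univ i), ← mul_assoc, Function.update_self, ← pow_succ']
          congr 1
          · congr 1
            omega
          · refine Finset.prod_congr rfl fun j hj => ?_
            rw [Function.update_of_ne (Finset.ne_of_mem_erase hj)]
        · have := (ht j).1
          by_cases hj : j = i
          · subst hj
            rw [Function.update_self] at this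
            exact this.trans (Finset.erase_subset _ _)
          · simpa [hj] using this
    have hrec := sub_smul_divDiff F s i hx hy
    have hxy' : x - y ≠ 0 := sub_ne_zero.2 hxy
    -- The nodes x and y are more than ‖d i‖ apart, so d i / (x - y) has norm at most 1 and
    -- preserves W.
    have e1 : e⁻¹ • divDiff F s = (d i / (x - y)) • ((e * d i)⁻¹ •
        divDiff F (Function.update s i ((s i).erase y)) - (e * d i)⁻¹ •
        divDiff F (Function.update s i ((s i).erase x))) := by
      rw [← smul_sub, ← hrec, smul_smul, smul_smul]
      congr 1
      have := hd i
      rw [mul_inv]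
      field_simp
    rw [e1]
    refine hW _ ?_ _ (W.sub_mem (key y hy x hx (Ne.symm hxy)) (key x hx y hy hxy))
    rw [norm_div]
    exact div_le_one_of_le₀ hlt.le (norm_nonneg _)

end Estimates

theorem exists_mem_piFinset_apply_eq {ι K : Type*} [Fintype ι] {s : ι → Finset K}
    (hs : ∀ i, (s i).Nonempty) {i : ι}
    {u : K} (hu : u ∈ s i) : ∃ z ∈ Fintype.piFinset s, z i = u := by
  choose y hy using hs
  refine ⟨Function.update y i u, Fintype.mem_piFinset.2 fun j => ?_, Function.update_self _ _ _⟩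
  by_cases h : j = i
  · subst h; simpa using hu
  · simpa [h] using hy j

/-! ### Divided differences of functions with frozen variables -/

section Algebra

variable {ι K E : Type*} [Fintype ι] [Field K] [AddCommGroup E] [Module K E]

/-- Exhibits the coefficients of the Newton polynomial as finite combinations of the functions
obtained from F by freezing the variables in J. The singleton {0} outside J merely makes the index
grid trivial there. -/
theorem divDiff_piecewise_singleton (J : Finset ι) (A : ι → Finset K) (F : (ι → K) → E)
    (x : ι → K) :
    divDiff F (J.piecewise A fun i => {x i}) =
      ∑ q ∈ Fintype.piFinset (J.piecewise A fun _ => {0}),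
        (∏ i ∈ J, weight (A i) (q i)) • F (J.piecewise q x) := by
  unfold divDiff
  refine Finset.sum_nbij' (fun q => J.piecewise q 0) (fun q => J.piecewise q x) ?_ ?_ ?_ ?_ ?_
  · intro q hq
    refine Fintype.mem_piFinset.2 fun i => ?_
    have := Fintype.mem_piFinset.1 hq i
    by_cases hi : i ∈ J <;> simp_all
  · intro q hq
    refine Fintype.mem_piFinset.2 fun i => ?_
    have := Fintype.mem_piFinset.1 hq i
    by_cases hi : i ∈ J <;> simp_all
  · intro q hq
    funext i
    have := Fintype.mem_piFinset.1 hq i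
    by_cases hi : i ∈ J <;> simp_all
  · intro q hq
    funext i
    have := Fintype.mem_piFinset.1 hq i
    by_cases hi : i ∈ J <;> simp_all
  · intro q hq
    have hq' : J.piecewise (J.piecewise q 0) x = q := by
      funext i
      have := Fintype.mem_piFinset.1 hq i
      by_cases hi : i ∈ J <;> simp_all
    rw [hq', ← Finset.prod_subset (Finset.subset_univ J)]
    · congr 1
      refine Finset.prod_congr rfl fun i hi => by simp [hi]
    · intro i _ hi
      have := Fintype.mem_piFinset.1 hq i
      simp_all [weight_singleton]

theorem divDiff_freeze (J : Finset ι) (F : (ι → K) → E) (q : ι → K) (t : ι → Finset K) :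
    divDiff (fun x => F (J.piecewise q x)) t =
      (∏ i ∈ J, divDiffOne (fun _ => 1) (t i)) •
        divDiff F (J.piecewise (fun i => {q i}) t) := by
  rw [← divDiff_prod_smul_piecewise]
  congr 1
  funext x
  rw [Finset.prod_const_one, one_smul, ← divDiff_singleton F]
  congr 1
  funext i
  by_cases hi : i ∈ J <;> simp [hi]

theorem divDiffOne_one {t : Finset K} {n : ℕ} (h : t.card = n + 1) :
    divDiffOne (fun _ => 1) t = if n = 0 then 1 else 0 := by
  split_ifs with h0
  · exact divDiffOne_one_of_card_eq_one (by omega)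
  · exact divDiffOne_one_of_one_lt_card (by omega)

theorem divDiff_const (e : E) (t : ι → Finset K) :
    divDiff (fun _ => e) t = (∏ i, divDiffOne (fun _ => 1) (t i)) • e := by
  have := divDiff_freeze Finset.univ (fun _ : ι → K => e) 0 t
  rw [this]
  congr 1
  simp only [Finset.piecewise_univ]
  exact divDiff_singleton _ _

end Algebra

/-! ### Limits of divided differences at a point, and their stability -/

section Limits

variable {ι K E : Type*} [Fintype ι] [NormedField K] [AddCommGroup E] [Module K E]
  [TopologicalSpace E]

/-- The filter of families of node sets of cardinalities `γ i + 1`, with all grid points in `U`,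
which shrink to the point `x`. -/
def nearDiag (U : Set (ι → K)) (γ : ι → ℕ) (x : ι → K) : Filter (ι → Finset K) :=
  (Filter.comap (fun s => (Fintype.piFinset s : Set (ι → K))) (𝓝[U] x).smallSets) ⊓
    Filter.principal {s | ∀ i, (s i).card = γ i + 1}

theorem tendsto_nearDiag_iff {β : Type*} {l : Filter β} {Φ : β → ι → Finset K}
    {U : Set (ι → K)} {γ : ι → ℕ} {x : ι → K} :
    Filter.Tendsto Φ l (nearDiag U γ x) ↔
      (∀ O ∈ 𝓝[U] x, ∀ᶠ b in l, ∀ z ∈ Fintype.piFinset (Φ b), z ∈ O) ∧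
        ∀ᶠ b in l, ∀ i, (Φ b i).card = γ i + 1 := by
  rw [nearDiag, Filter.tendsto_inf, Filter.tendsto_comap_iff, Filter.tendsto_smallSets_iff,
    Filter.tendsto_principal]
  rfl

theorem eventually_nearDiag_mem {U : Set (ι → K)} {γ : ι → ℕ} {x : ι → K} {O : Set (ι → K)}
    (hO : O ∈ 𝓝[U] x) : ∀ᶠ s in nearDiag U γ x, ∀ z ∈ Fintype.piFinset s, z ∈ O :=
  (tendsto_nearDiag_iff.1 Filter.tendsto_id).1 O hO

theorem eventually_nearDiag_card (U : Set (ι → K)) (γ : ι → ℕ) (x : ι → K) :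
    ∀ᶠ s in nearDiag U γ x, ∀ i, (s i).card = γ i + 1 :=
  (tendsto_nearDiag_iff.1 Filter.tendsto_id).2

/-- The divided differences of `F` of order `γ` have a limit as the nodes shrink to `x`. -/
def HasDiagLim (U : Set (ι → K)) (γ : ι → ℕ) (F : (ι → K) → E) (x : ι → K) : Prop :=
  ∃ y, Filter.Tendsto (divDiff F) (nearDiag U γ x) (𝓝 y)

theorem HasDiagLim.congr {U : Set (ι → K)} {γ : ι → ℕ} {F G : (ι → K) → E} {x : ι → K}
    (hF : HasDiagLim U γ F x) (h : ∀ᶠ z in 𝓝[U] x, F z = G z) : HasDiagLim U γ G x := by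
  obtain ⟨y, hy⟩ := hF
  refine ⟨y, hy.congr' ?_⟩
  filter_upwards [eventually_nearDiag_mem h] with s hs
  exact divDiff_congr hs

theorem HasDiagLim.const (U : Set (ι → K)) (γ : ι → ℕ) (e : E) (x : ι → K) :
    HasDiagLim U γ (fun _ => e) x := by
  refine ⟨(∏ i, if γ i = 0 then (1 : K) else 0) • e, tendsto_const_nhds.congr' ?_⟩
  filter_upwards [eventually_nearDiag_card U γ x] with s hs
  rw [divDiff_const]
  simp only [divDiffOne_one (hs _)]

theorem HasDiagLim.sum [ContinuousAdd E] {σ : Type*} {T : Finset σ} {U : Set (ι → K)}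
    {γ : ι → ℕ} {F : σ → (ι → K) → E} {x : ι → K} (hF : ∀ k ∈ T, HasDiagLim U γ (F k) x) :
    HasDiagLim U γ (fun z => ∑ k ∈ T, F k z) x := by
  choose! y hy using hF
  refine ⟨∑ k ∈ T, y k, (tendsto_finsetSum T hy).congr fun s => ?_⟩
  rw [divDiff_sum]

theorem HasDiagLim.const_smul [ContinuousSMul K E] {U : Set (ι → K)}
    {γ : ι → ℕ} {F : (ι → K) → E} {x : ι → K} (hF : HasDiagLim U γ F x) (c : K) :
    HasDiagLim U γ (fun z => c • F z) x := by
  obtain ⟨y, hy⟩ := hF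
  exact ⟨c • y, (hy.const_smul c).congr fun s => (divDiff_smul c F s).symm⟩

theorem HasDiagLim.coord_smul [ContinuousAdd E] [ContinuousSMul K E] {U : Set (ι → K)}
    {γ : ι → ℕ} {F : (ι → K) → E} {x : ι → K} {i : ι} (c : K) (hF : HasDiagLim U γ F x)
    (hF' : γ i ≠ 0 → HasDiagLim U (Function.update γ i (γ i - 1)) F x) :
    HasDiagLim U γ (fun z => (z i - c) • F z) x := by
  -- A node of `s i` for the Leibniz rule; it tends to x i. The default 0 is irrelevant, since along
  -- the filter `s i` is nonempty.
  set pick : (ι → Finset K) → K := fun s => if h : (s i).Nonempty then h.choose else 0 with hp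
  have hpick : ∀ᶠ s in nearDiag U γ x, pick s ∈ s i := by
    filter_upwards [eventually_nearDiag_card U γ x] with s hs
    have h : (s i).Nonempty := Finset.card_pos.1 (by rw [hs i]; omega)
    simp only [hp, h, dif_pos]
    exact h.choose_spec
  have hlim : Filter.Tendsto pick (nearDiag U γ x) (𝓝 (x i)) := by
    intro O hO
    change ∀ᶠ s in nearDiag U γ x, pick s ∈ O
    have hO' : {z : ι → K | z i ∈ O} ∈ 𝓝[U] x :=
      mem_nhdsWithin_of_mem_nhds ((continuous_apply i).continuousAt hO)
    filter_upwards [hpick, eventually_nearDiag_mem hO', eventually_nearDiag_card U γ x]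
      with s h1 h2 h3
    obtain ⟨z, hz, hzi⟩ := exists_mem_piFinset_apply_eq
      (fun k => Finset.card_pos.1 (by rw [h3 k]; omega)) h1
    exact hzi ▸ h2 z hz
  obtain ⟨y, hy⟩ := hF
  -- With a single node in direction i, erasing it would leave no node; there the coordinate factor
  -- is constant on the grid instead.
  by_cases h0 : γ i = 0
  · refine ⟨(x i - c) • y, ((hlim.sub_const c).smul hy).congr' ?_⟩
    filter_upwards [hpick, eventually_nearDiag_card U γ x] with s h1 h3
    have hcard := h3 i
    rw [h0, zero_add, Finset.card_eq_one] at hcard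
    obtain ⟨u, hu⟩ := hcard
    have hpu : pick s = u := by rw [hu] at h1; exact Finset.mem_singleton.1 h1
    rw [← divDiff_smul]
    refine divDiff_congr fun z hz => ?_
    have := Fintype.mem_piFinset.1 hz i
    rw [hu, Finset.mem_singleton] at this
    rw [this, hpu]
  · obtain ⟨y', hy'⟩ := hF' h0
    have hT : Filter.Tendsto (fun s => Function.update s i ((s i).erase (pick s)))
        (nearDiag U γ x) (nearDiag U (Function.update γ i (γ i - 1)) x) := by
      refine tendsto_nearDiag_iff.2 ⟨fun O hO => ?_, ?_⟩
      · filter_upwards [eventually_nearDiag_mem hO] with s hs z hz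
        refine hs z (Fintype.piFinset_subset _ _ (fun k => ?_) hz)
        by_cases hk : k = i
        · subst hk; simpa using Finset.erase_subset _ _
        · simp [hk]
      · filter_upwards [hpick, eventually_nearDiag_card U γ x] with s h1 h3 k
        by_cases hk : k = i
        · subst hk
          simp only [Function.update_self, Finset.card_erase_of_mem h1, h3 k]
          omega
        · simp [hk, h3 k]
    refine ⟨(x i - c) • y + y', (((hlim.sub_const c).smul hy).add (hy'.comp hT)).congr' ?_⟩
    filter_upwards [hpick] with s h1
    exact (divDiff_coord_smul F s i c h1).symm

theorem HasDiagLim.freeze [ContinuousSMul K E] {J : Finset ι} {U : Set (ι → K)}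
    {γ : ι → ℕ} {F : (ι → K) → E} {x q : ι → K}
    (hF : HasDiagLim U (J.piecewise 0 γ) F (J.piecewise q x))
    (hq : ∀ᶠ z in 𝓝[U] x, J.piecewise q z ∈ U) :
    HasDiagLim U γ (fun z => F (J.piecewise q z)) x := by
  obtain ⟨y, hy⟩ := hF
  have hcont : Continuous fun z : ι → K => J.piecewise q z := by
    refine continuous_pi fun i => ?_
    by_cases hi : i ∈ J
    · simpa [hi] using continuous_const
    · simpa [hi] using continuous_apply i
  have hlim : Filter.Tendsto (fun z : ι → K => J.piecewise q z) (𝓝[U] x)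
      (𝓝[U] (J.piecewise q x)) :=
    tendsto_nhdsWithin_iff.2 ⟨hcont.continuousAt.mono_left nhdsWithin_le_nhds, hq⟩
  have hT : Filter.Tendsto (fun t => J.piecewise (fun i => {q i}) t) (nearDiag U γ x)
      (nearDiag U (J.piecewise 0 γ) (J.piecewise q x)) := by
    refine tendsto_nearDiag_iff.2 ⟨fun O hO => ?_, ?_⟩
    · filter_upwards [eventually_nearDiag_mem (hlim hO), eventually_nearDiag_card U γ x]
        with t ht hc z hz
      have hne : ∀ i, (t i).Nonempty := fun i => Finset.card_pos.1 (by rw [hc i]; omega)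
      choose u hu using hne
      have hz' := Fintype.mem_piFinset.1 hz
      have : J.piecewise q (J.piecewise u z) = z := by
        funext i
        have := hz' i
        by_cases hi : i ∈ J <;> simp_all
      rw [← this]
      refine ht _ (Fintype.mem_piFinset.2 fun i => ?_)
      have := hz' i
      by_cases hi : i ∈ J <;> simp_all
    · filter_upwards [eventually_nearDiag_card U γ x] with t hc i
      by_cases hi : i ∈ J <;> simp [hi, hc i]
  refine ⟨(∏ i ∈ J, if γ i = 0 then (1 : K) else 0) • y,
    ((hy.comp hT).const_smul _).congr' ?_⟩
  filter_upwards [eventually_nearDiag_card U γ x] with t hc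
  rw [divDiff_freeze]
  simp only [divDiffOne_one (hc _), Function.comp]

/-- The Leibniz rule also involves the order lowered by one, so all orders of a lower set are
treated simultaneously. -/
theorem hasDiagLim_prod_sub_smul [ContinuousAdd E] [ContinuousSMul K E] {U : Set (ι → K)}
    {N : Set (ι → ℕ)} (hN : IsLowerSet N) {F : (ι → K) → E} {x : ι → K}
    (hF : ∀ γ ∈ N, HasDiagLim U γ F x) {σ : Type*} (T : Finset σ) (f : σ → ι) (c : σ → K) :
    ∀ γ ∈ N, HasDiagLim U γ (fun z => (∏ p ∈ T, (z (f p) - c p)) • F z) x := by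
  induction T using Finset.induction_on with
  | empty => simpa using hF
  | insert p T hp ih =>
    intro γ hγ
    simp only [Finset.prod_insert hp, mul_smul]
    refine HasDiagLim.coord_smul _ (ih γ hγ) fun _ => ih _ (hN ?_ hγ)
    intro i
    by_cases hi : i = f p
    · subst hi; simp
    · simp [hi]

theorem hasDiagLim_newton [ContinuousAdd E] [ContinuousSMul K E] {U : Set (ι → K)}
    {N : Set (ι → ℕ)} (hN : IsLowerSet N) {F : (ι → K) → E}
    (hF : ∀ z ∈ U, ∀ γ ∈ N, HasDiagLim U γ F z) {x : ι → K} (hx : x ∈ U) {J : Finset ι} (r : ℕ)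
    {a : ι → ℕ → K}
    (ha : ∀ q : ι → K, (∀ i ∈ J, q i ∈ range (a i)) → ∀ᶠ z in 𝓝[U] x, J.piecewise q z ∈ U) :
    ∀ γ ∈ N, HasDiagLim U γ (newton J r a F) x := by
  intro γ hγ
  unfold newton
  refine HasDiagLim.sum fun m _ => ?_
  have h1 : ∀ γ ∈ N, HasDiagLim U γ
      (fun z => divDiff F (J.piecewise (initNodes a (m + 1)) fun i => {z i})) x := by
    intro γ hγ
    simp only [divDiff_piecewise_singleton]
    refine HasDiagLim.sum fun q hq => HasDiagLim.const_smul ?_ _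
    have hqU : ∀ᶠ z in 𝓝[U] x, J.piecewise q z ∈ U := by
      refine ha q fun i hi => ?_
      have := Fintype.mem_piFinset.1 hq i
      simp only [hi, Finset.piecewise_eq_of_mem, initNodes, Finset.mem_image] at this
      obtain ⟨k, -, hk⟩ := this
      exact ⟨k, hk⟩
    refine HasDiagLim.freeze (hF _ (hqU.self_of_nhdsWithin hx) _ (hN ?_ hγ)) hqU
    intro i
    by_cases hi : i ∈ J <;> simp [hi]
  have h2 := hasDiagLim_prod_sub_smul hN h1 (J.sigma fun i => Finset.range (m i))
    (fun p => p.1) (fun p => a p.1 p.2) γ hγ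
  simpa only [Finset.prod_sigma] using h2

theorem hasDiagLim_monomial [ContinuousAdd E] [ContinuousSMul K E] (U : Set (ι → K))
    (β γ : ι → ℕ) (e : E) (x : ι → K) :
    HasDiagLim U γ (fun z => (∏ i, z i ^ β i) • e) x := by
  have := hasDiagLim_prod_sub_smul (N := univ) isLowerSet_univ
    (fun γ _ => HasDiagLim.const U γ e x)
    (Finset.univ.sigma fun i => Finset.range (β i)) (fun p => p.1) (fun _ => (0 : K)) γ (mem_univ _)
  simpa only [Finset.prod_sigma, sub_zero, Finset.prod_const, Finset.card_range] using this

end Limits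

/-! ### Continuous extensions versus limits at the diagonal -/

section Extensions

theorem exists_injective_image_eq {K : Type*} {s : Finset K} {m : ℕ} (h : s.card = m) :
    ∃ z : Fin m → K, Function.Injective z ∧ Finset.univ.image z = s := by
  refine ⟨fun k => ((s.equivFinOfCardEq h).symm k).1,
    Subtype.val_injective.comp (Equiv.injective _), ?_⟩
  ext u
  simp only [Finset.mem_image, Finset.mem_univ, true_and]
  refine ⟨?_, fun hu => ⟨s.equivFinOfCardEq h ⟨u, hu⟩, by simp⟩⟩
  rintro ⟨k, rfl⟩
  exact ((s.equivFinOfCardEq h).symm k).2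

variable {ι K E : Type*} [Fintype ι] [NormedField K] [AddCommGroup E] [Module K E]

theorem diffQuot_restr_eq_divDiff {U V : Set (ι → K)} (hV : V ⊆ U) {f : U → E}
    {F : (ι → K) → E} (hF : ∀ u : U, F u = f u) {γ : ι → ℕ} (z : extDom V γ)
    (hz : ∀ i, Function.Injective (z.1 i)) :
    diffQuot (restr hV f) γ z = divDiff F fun i => Finset.univ.image (z.1 i) := by
  unfold diffQuot divDiff
  refine Finset.sum_bij (fun j _ i => z.1 i (j i)) ?_ ?_ ?_ ?_
  · intro j _
    exact Fintype.mem_piFinset.2 fun i => Finset.mem_image_of_mem _ (Finset.mem_univ _)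
  · intro j _ j' _ h
    exact funext fun i => hz i (congrFun h i)
  · intro x hx
    have h : ∀ i, ∃ k, z.1 i k = x i := fun i => by simpa using Fintype.mem_piFinset.1 hx i
    choose j hj using h
    exact ⟨j, Finset.mem_univ _, funext hj⟩
  · intro j _
    rw [restr, ← hF]
    congr 1
    refine Finset.prod_congr rfl fun i _ => ?_
    rw [weight, if_pos (Finset.mem_image_of_mem _ (Finset.mem_univ _)),
      ← Finset.image_erase (hz i), Finset.prod_image fun a _ b _ h => hz i h]

variable [TopologicalSpace E]

/-- The divided differences of `F` of order `γ` extend continuously to `V^{<γ>}`. -/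
def HasExt (F : (ι → K) → E) (V : Set (ι → K)) (γ : ι → ℕ) : Prop :=
  ∃ g : C(extDom V γ, E), ∀ z : extDom V γ, (∀ i, Function.Injective (z.1 i)) →
    g z = divDiff F fun i => Finset.univ.image (z.1 i)

theorem isC_iff_hasExt {U : Set (ι → K)} {α : ι → ℕ∞} {f : U → E} {F : (ι → K) → E}
    (hF : ∀ u : U, F u = f u) :
    IsC U α f ↔ ∀ V, IsOpenCartesianIn V U → ∀ γ : ι → ℕ, (∀ i, (γ i : ℕ∞) ≤ α i) →
      HasExt F V γ := by
  refine forall_congr' fun V => forall_congr' fun hV => forall_congr' fun γ =>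
    forall_congr' fun _ => exists_congr fun g => forall_congr' fun z => forall_congr' fun hz => ?_
  rw [diffQuot_restr_eq_divDiff hV.subset hF z hz]

/-- The limit is the value of the continuous extension at the point all of whose entries in
direction i equal x i. -/
theorem hasDiagLim_of_hasExt {U V : Set (ι → K)} (hV : IsOpenCartesianIn V U) {γ : ι → ℕ}
    {F : (ι → K) → E} (hF : HasExt F V γ) {x : ι → K} (hx : x ∈ V) : HasDiagLim U γ F x := by
  obtain ⟨g, hg⟩ := hF
  have hVx : V ∈ 𝓝[U] x := by
    obtain ⟨⟨O, hO, rfl⟩, -⟩ := hV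
    exact Filter.inter_mem self_mem_nhdsWithin (mem_nhdsWithin_of_mem_nhds (hO.mem_nhds hx.2))
  set x' : extDom V γ := ⟨fun i _ => x i, fun _ => hx⟩ with hx'
  refine ⟨g x', fun O hO => ?_⟩
  change ∀ᶠ s in nearDiag U γ x, divDiff F s ∈ O
  obtain ⟨ρ, hρ, hball⟩ := Metric.mem_nhds_iff.1 (g.continuous.continuousAt hO)
  filter_upwards [eventually_nearDiag_card U γ x, eventually_nearDiag_mem hVx,
    eventually_nearDiag_mem (mem_nhdsWithin_of_mem_nhds (Metric.ball_mem_nhds x hρ))]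
    with s hc hsV hsb
  choose z hzi hzs using fun i => exists_injective_image_eq (hc i)
  have hz : ∀ i k, z i k ∈ s i := fun i k => by
    rw [← hzs i]; exact Finset.mem_image_of_mem _ (Finset.mem_univ _)
  have hzV : z ∈ extDom V γ := fun j => hsV _ (Fintype.mem_piFinset.2 fun i => hz i (j i))
  have hs : divDiff F s = g ⟨z, hzV⟩ := by
    rw [hg _ hzi]
    simp only [hzs]
  rw [hs]
  refine hball ?_
  rw [Metric.mem_ball, Subtype.dist_eq, dist_pi_lt_iff hρ]
  intro i
  rw [dist_pi_lt_iff hρ]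
  intro k
  obtain ⟨w, hw, hwi⟩ := exists_mem_piFinset_apply_eq (fun l => ⟨z l 0, hz l 0⟩) (hz i k)
  change dist (z i k) (x i) < ρ
  rw [← hwi]
  exact (dist_pi_lt_iff hρ).1 (hsb w hw) i

theorem hasExt_of_hasDiagLim [IsTopologicalAddGroup E] [ContinuousSMul K E] [T2Space E]
    {U V : Set (ι → K)} (hV : IsOpenCartesianIn V U) {γ : ι → ℕ} {F : (ι → K) → E}
    (hF : ∀ x ∈ V, ∀ γ' ≤ γ, HasDiagLim U γ' F x) : HasExt F V γ := by
  set D : Set ((i : ι) → Fin (γ i + 1) → K) :=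
    {z | z ∈ extDom V γ ∧ ∀ i, Function.Injective (z i)} with hD
  -- Limits exist for all nonempty selections T of the entries, by induction on their total number.
  -- If the selected entries of z coincide in each direction, the limit at a single point applies;
  -- otherwise two entries have distinct limits, and the recursion divides by a difference with
  -- nonzero limit.
  have key : ∀ z ∈ extDom V γ, ∀ T : (i : ι) → Finset (Fin (γ i + 1)), (∀ i, (T i).Nonempty) →
      ∃ y, Filter.Tendsto (fun z' : (i : ι) → Fin (γ i + 1) → K =>
        divDiff F fun i => (T i).image (z' i)) (𝓝[D] z) (𝓝 y) := by
    intro z hz T hT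
    induction hN : ∑ i, (T i).card using Nat.strong_induction_on generalizing T with
    | _ N ih =>
    by_cases hall : ∀ i, ∀ k ∈ T i, ∀ l ∈ T i, z i k = z i l
    · choose k hk using hT
      obtain ⟨y, hy⟩ := hF _ (hz k) (fun i => (T i).card - 1) (fun i => by
        have := (T i).card_le_univ
        rw [Fintype.card_fin] at this
        simp only
        omega)
      refine ⟨y, hy.comp (tendsto_nearDiag_iff.2 ⟨fun O hO => ?_, ?_⟩)⟩
      · obtain ⟨O', hO', hsub⟩ := mem_nhdsWithin_iff_exists_mem_nhds_inter.1 hO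
        have h1 : ∀ j : (i : ι) → Fin (γ i + 1), (∀ i, j i ∈ T i) →
            ∀ᶠ z' in 𝓝[D] z, (fun i => z' i (j i)) ∈ O' := by
          intro j hj
          have hc : Continuous fun z' : (i : ι) → Fin (γ i + 1) → K => fun i => z' i (j i) := by
            fun_prop
          refine nhdsWithin_le_nhds (hc.continuousAt ?_)
          rwa [funext fun i => hall i (j i) (hj i) (k i) (hk i)]
        have h2 := Filter.eventually_all.2 fun j => Filter.eventually_imp_distrib_left.2 (h1 j)
        filter_upwards [h2, self_mem_nhdsWithin] with z' hz' hzD w hw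
        have h3 : ∀ i, ∃ j ∈ T i, z' i j = w i := fun i => by
          simpa using Fintype.mem_piFinset.1 hw i
        choose j hj hjw using h3
        rw [← funext hjw]
        exact hsub ⟨hz' j hj, hV.subset (hzD.1 j)⟩
      · filter_upwards [self_mem_nhdsWithin] with z' hzD i
        rw [Finset.card_image_of_injective _ (hzD.2 i)]
        have := Finset.card_pos.2 ⟨k i, hk i⟩
        omega
    · push Not at hall
      obtain ⟨i, k, hk, l, hl, hne⟩ := hall
      have hkl : k ≠ l := fun h => hne (h ▸ rfl)
      have hstep : ∀ m ∈ T i, ∃ y, Filter.Tendsto (fun z' : (i : ι) → Fin (γ i + 1) → K =>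
          divDiff F (Function.update (fun i => (T i).image (z' i)) i
            (((T i).image (z' i)).erase (z' i m)))) (𝓝[D] z) (𝓝 y) := by
        intro m hm
        obtain ⟨y, hy⟩ := ih (∑ j, (Function.update T i ((T i).erase m) j).card) (by
          rw [← hN]
          refine Finset.sum_lt_sum (fun j _ => ?_) ⟨i, Finset.mem_univ i, ?_⟩
          · by_cases hj : j = i
            · subst hj; simpa using Finset.card_erase_le
            · simp [hj]
          · rw [Function.update_self]
            exact Finset.card_erase_lt_of_mem hm) _ (fun j => by
          by_cases hj : j = i
          · subst hj
            rw [Function.update_self]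
            by_cases hmk : m = k
            · exact ⟨l, Finset.mem_erase.2 ⟨fun h => hkl (hmk ▸ h.symm), hl⟩⟩
            · exact ⟨k, Finset.mem_erase.2 ⟨Ne.symm hmk, hk⟩⟩
          · simpa [hj] using hT j) rfl
        refine ⟨y, hy.congr' ?_⟩
        filter_upwards [self_mem_nhdsWithin] with z' hzD
        congr 1
        funext j
        by_cases hj : j = i
        · subst hj
          rw [Function.update_self, Function.update_self, Finset.image_erase (hzD.2 j)]
        · rw [Function.update_of_ne hj, Function.update_of_ne hj]
      obtain ⟨y, hy⟩ := hstep l hl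
      obtain ⟨y', hy'⟩ := hstep k hk
      have hlim : Filter.Tendsto (fun z' : (i : ι) → Fin (γ i + 1) → K => (z' i k - z' i l)⁻¹)
          (𝓝[D] z) (𝓝 (z i k - z i l)⁻¹) := by
        refine Filter.Tendsto.inv₀ ?_ (sub_ne_zero.2 hne)
        have hc : Continuous fun z' : (i : ι) → Fin (γ i + 1) → K => z' i k - z' i l := by
          fun_prop
        exact hc.continuousAt.mono_left nhdsWithin_le_nhds
      refine ⟨_, (hlim.smul (hy.sub hy')).congr' ?_⟩
      filter_upwards [self_mem_nhdsWithin] with z' hzD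
      rw [← sub_smul_divDiff F (fun i => (T i).image (z' i)) i (Finset.mem_image_of_mem _ hk)
        (Finset.mem_image_of_mem _ hl), smul_smul, inv_mul_cancel₀, one_smul]
      exact sub_ne_zero.2 fun h => hkl (hzD.2 i h)
  have hlim := fun z hz => key z hz (fun _ => Finset.univ) fun _ => Finset.univ_nonempty
  have hdense : extDom V γ ⊆ closure D := by
    have := Subtype.dense_iff.1 (dense_injective hV.2 γ)
    refine this.trans (closure_mono ?_)
    rintro _ ⟨z, hz, rfl⟩
    exact ⟨z.2, hz⟩
  -- Limits along a dense subset give a continuous extension, because the topological group E is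
  -- regular.
  have hcont := continuousOn_extendFrom hdense hlim
  refine ⟨⟨_, continuousOn_iff_continuous_domRestrict.1 hcont⟩, fun z hz => ?_⟩
  obtain ⟨y, hy⟩ := hlim z.1 z.2
  have h1 := extendFrom_eq (hdense z.2) hy
  have h2 := tendsto_nhds_unique (hy.mono_left (pure_le_nhdsWithin (show z.1 ∈ D from ⟨z.2, hz⟩)))
    (tendsto_pure_nhds _ _)
  exact h1.trans h2

end Extensions

/-! ### Uniform continuity of divided differences -/

section UniformContinuity

variable {ι K E : Type*} [Fintype ι] [NormedField K] [AddCommGroup E] [Module K E]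
  [TopologicalSpace E] [IsTopologicalAddGroup E]

/-- Uniform continuity of divided differences near a compact set. -/
theorem exists_divDiff_sub_divDiff_mem {v : ι → Set K} {γ : ι → ℕ}
    {F : (ι → K) → E} (hF : HasExt F (univ.pi v) γ) {C : ι → Set K} (hC : ∀ i, IsCompact (C i))
    (hCv : ∀ i, C i ⊆ v i) {W : AddSubgroup E} (hW : IsOpen (W : Set E)) :
    ∃ ρ > 0, ∀ t t' : ι → Finset K, (∀ i, (t i).card = γ i + 1 ∧ (t' i).card = γ i + 1) →
      (∀ i, (t i : Set K) ⊆ v i ∧ (t' i : Set K) ⊆ v i) →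
      (∀ i, (t i = t' i ∧ ∀ x ∈ t i, ∃ c ∈ C i, ‖x - c‖ < ρ) ∨
        ∃ c ∈ C i, ∀ x, x ∈ t i ∨ x ∈ t' i → ‖x - c‖ < ρ) →
      divDiff F t - divDiff F t' ∈ W := by
  obtain ⟨g, hg⟩ := hF
  set L : Set (extDom (univ.pi v) γ) := {z | ∀ i k, z.1 i k ∈ C i} with hL
  have hLc : IsCompact L := by
    rw [Subtype.isCompact_iff]
    have : ((↑) '' L : Set ((i : ι) → Fin (γ i + 1) → K)) =
        univ.pi fun i => univ.pi fun _ => C i := by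
      ext z
      constructor
      · rintro ⟨z, hz, rfl⟩ i _ k _
        exact hz i k
      · intro hz
        exact ⟨⟨z, fun j i _ => hCv i (hz i trivial (j i) trivial)⟩,
          fun i k => hz i trivial k trivial, rfl⟩
    rw [this]
    exact isCompact_univ_pi fun i => isCompact_univ_pi fun _ => hC i
  obtain ⟨ρ, hρ, hball⟩ := lebesgue_number_lemma_of_metric (s := L)
    (c := fun w => {z | g z - g w ∈ W}) hLc
    (fun w => hW.preimage (g.continuous.sub continuous_const))
    (fun w _ => mem_iUnion.2 ⟨w, by simp⟩)
  refine ⟨ρ, hρ, fun t t' hc hv h => ?_⟩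
  -- Enumerate both node sets so that corresponding nodes are close to a common ζ with entries in C:
  -- identical enumerations where the sets agree, a constant ζ where both lie near one point.
  have hex : ∀ i, ∃ z z' ζ : Fin (γ i + 1) → K,
      (Function.Injective z ∧ Finset.univ.image z = t i) ∧
      (Function.Injective z' ∧ Finset.univ.image z' = t' i) ∧
      ∀ k, ζ k ∈ C i ∧ ‖z k - ζ k‖ < ρ ∧ ‖z' k - ζ k‖ < ρ := by
    intro i
    obtain ⟨z, hz, hzt⟩ := exists_injective_image_eq (hc i).1
    have hmem : ∀ k, z k ∈ t i := fun k =>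
      hzt ▸ Finset.mem_image_of_mem _ (Finset.mem_univ _)
    rcases h i with ⟨heq, hnear⟩ | ⟨c, hcC, hnear⟩
    · choose ζ hζ using fun k => hnear (z k) (hmem k)
      exact ⟨z, z, ζ, ⟨hz, hzt⟩, ⟨hz, heq ▸ hzt⟩, fun k => ⟨(hζ k).1, (hζ k).2, (hζ k).2⟩⟩
    · obtain ⟨z', hz', hzt'⟩ := exists_injective_image_eq (hc i).2
      have hmem' : ∀ k, z' k ∈ t' i := fun k =>
        hzt' ▸ Finset.mem_image_of_mem _ (Finset.mem_univ _)
      exact ⟨z, z', fun _ => c, ⟨hz, hzt⟩, ⟨hz', hzt'⟩, fun k =>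
        ⟨hcC, hnear _ (Or.inl (hmem k)), hnear _ (Or.inr (hmem' k))⟩⟩
  choose z z' ζ hz hz' hζ using hex
  have hzv : z ∈ extDom (univ.pi v) γ := fun j i _ => (hv i).1 (by
    rw [← (hz i).2]; exact Finset.mem_coe.2 (Finset.mem_image_of_mem _ (Finset.mem_univ _)))
  have hzv' : z' ∈ extDom (univ.pi v) γ := fun j i _ => (hv i).2 (by
    rw [← (hz' i).2]; exact Finset.mem_coe.2 (Finset.mem_image_of_mem _ (Finset.mem_univ _)))
  have hζv : ζ ∈ extDom (univ.pi v) γ := fun j i _ => hCv i (hζ i (j i)).1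
  obtain ⟨w, hw⟩ := hball ⟨ζ, hζv⟩ fun i k => (hζ i k).1
  have e1 : divDiff F t = g ⟨z, hzv⟩ := by
    rw [hg _ fun i => (hz i).1]; simp only [(hz _).2]
  have e2 : divDiff F t' = g ⟨z', hzv'⟩ := by
    rw [hg _ fun i => (hz' i).1]; simp only [(hz' _).2]
  have m1 : (⟨z, hzv⟩ : extDom (univ.pi v) γ) ∈ Metric.ball ⟨ζ, hζv⟩ ρ := by
    rw [Metric.mem_ball, Subtype.dist_eq, dist_pi_lt_iff hρ]
    exact fun i => (dist_pi_lt_iff hρ).2 fun k => by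
      rw [dist_eq_norm]; exact (hζ i k).2.1
  have m2 : (⟨z', hzv'⟩ : extDom (univ.pi v) γ) ∈ Metric.ball ⟨ζ, hζv⟩ ρ := by
    rw [Metric.mem_ball, Subtype.dist_eq, dist_pi_lt_iff hρ]
    exact fun i => (dist_pi_lt_iff hρ).2 fun k => by
      rw [dist_eq_norm]; exact (hζ i k).2.2
  rw [e1, e2, ← sub_sub_sub_cancel_right _ _ (g w)]
  exact W.sub_mem (hw m1) (hw m2)

end UniformContinuity

/-! ### Functions polynomial in some of the blocks -/

section PartialPolynomials

variable {ι τ : Type*} [Fintype ι]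

/-- The set of indices in the block `j`. -/
def block (b : ι → τ) (j : τ) : Finset ι := Finset.univ.filter fun i => b i = j

theorem mem_block {b : ι → τ} {j : τ} {i : ι} : i ∈ block b j ↔ b i = j := by simp [block]

/-- The multi-indices whose total degree in each block `j` is at most `r j`. -/
def blockDegLE (b : ι → τ) (r : τ → ℕ) : Set (ι → ℕ) := {γ | ∀ j, ∑ i ∈ block b j, γ i ≤ r j}

theorem isLowerSet_blockDegLE (b : ι → τ) (r : τ → ℕ) : IsLowerSet (blockDegLE b r) :=
  fun _ _ h hγ j => (Finset.sum_le_sum fun i _ => h i).trans (hγ j)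

theorem finite_blockDegLE (b : ι → τ) (r : τ → ℕ) : (blockDegLE b r).Finite :=
  (Set.finite_Iic fun i => r (b i)).subset fun _ hγ i =>
    (Finset.single_le_sum (fun _ _ => Nat.zero_le _) (mem_block.2 rfl)).trans (hγ (b i))

variable {K E : Type*} [Field K] [AddCommGroup E] [Module K E]

/-- The functions which are polynomial in the variables in the blocks in `S`, with coefficients
depending on the remaining variables. -/
def polySpan (K E : Type*) [Field K] [AddCommGroup E] [Module K E] (b : ι → τ) (r : τ → ℕ)
    (S : Finset τ) : Submodule K ((ι → K) → E) :=
  Submodule.span K {G | ∃ β ∈ blockDegLE b r, (∀ i, b i ∉ S → β i = 0) ∧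
    ∃ h : (ι → K) → E, (∀ x y, (∀ i, b i ∉ S → x i = y i) → h x = h y) ∧
      G = fun x => (∏ i, x i ^ β i) • h x}

theorem mem_polySpan_empty (b : ι → τ) (r : τ → ℕ) (F : (ι → K) → E) :
    F ∈ polySpan K E b r ∅ := by
  refine Submodule.subset_span ⟨0, fun j => by simp, fun _ _ => rfl, F, fun x y h => ?_, ?_⟩
  · rw [show x = y from funext fun i => h i (Finset.notMem_empty _)]
  · simp

theorem exists_finsupp_of_mem_polySpan {b : ι → τ} {r : τ → ℕ} {S : Finset τ}
    (hS : ∀ i, b i ∈ S) {F : (ι → K) → E} (hF : F ∈ polySpan K E b r S) :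
    ∃ a : (ι → ℕ) →₀ E, (∀ β, a β ≠ 0 → β ∈ blockDegLE b r) ∧
      ∀ x, F x = a.sum fun β c => (∏ i, x i ^ β i) • c := by
  induction hF using Submodule.span_induction with
  | mem F h =>
    obtain ⟨β, hβ, -, h, hh, rfl⟩ := h
    refine ⟨Finsupp.single β (h 0), fun β' hβ' => ?_, fun x => ?_⟩
    · rw [Finsupp.single_apply_ne_zero] at hβ'
      exact hβ'.1 ▸ hβ
    · rw [Finsupp.sum_single_index (a := β)
        (h := fun (β : ι → ℕ) (c : E) => (∏ i, x i ^ β i) • c) (smul_zero _)]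
      simp only
      rw [hh x 0 fun i hi => absurd (hS i) hi]
  | zero => exact ⟨0, fun β h => absurd rfl h, fun x => by simp⟩
  | add F G _ _ hF hG =>
    obtain ⟨a, ha, haF⟩ := hF
    obtain ⟨c, hc, hcG⟩ := hG
    refine ⟨a + c, fun β hβ => ?_, fun x => ?_⟩
    · by_cases h : a β = 0
      · exact hc β fun h' => hβ (by simp [h, h'])
      · exact ha β h
    · rw [Finsupp.sum_add_index' (fun _ => smul_zero _) (fun _ _ _ => smul_add _ _ _), ← haF,
        ← hcG]
      rfl
  | smul k F _ hF =>
    obtain ⟨a, ha, haF⟩ := hF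
    refine ⟨k • a, fun β hβ => ha β fun h => hβ (by simp [h]), fun x => ?_⟩
    rw [Finsupp.sum_smul_index' (fun _ => smul_zero _), Pi.smul_apply, haF, Finsupp.smul_sum]
    exact Finsupp.sum_congr fun β _ => smul_comm _ _ _

/-- The Newton factors supply degree at most r j in block j. Freezing that block changes no
exponent, as the monomials do not involve it yet, and makes the coefficients independent of it. -/
theorem newton_mem_polySpan {b : ι → τ} {r : τ → ℕ} {S : Finset τ} {j : τ} (hj : j ∉ S)
    (a : ι → ℕ → K) {F : (ι → K) → E} (hF : F ∈ polySpan K E b r S) :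
    newton (block b j) (r j) a F ∈ polySpan K E b r (insert j S) := by
  set J := block b j with hJ
  have key : ∀ m ∈ degreesLE J (r j), ∀ q : ι → K,
      (fun x => (∏ i ∈ J, ∏ k ∈ Finset.range (m i), (x i - a i k)) • F (J.piecewise q x)) ∈
        polySpan K E b r (insert j S) := by
    intro m hm q
    obtain ⟨hm0, hmr⟩ := mem_degreesLE.1 hm
    induction hF using Submodule.span_induction with
    | zero =>
      simp only [Pi.zero_apply, smul_zero]
      exact Submodule.zero_mem _
    | add F G _ _ hF hG =>
      simp only [Pi.add_apply, smul_add]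
      exact Submodule.add_mem _ hF hG
    | smul c F _ hF =>
      simp only [Pi.smul_apply, smul_comm _ c]
      exact Submodule.smul_mem _ c hF
    | mem F h =>
      obtain ⟨β, hβ, hβ0, h, hh, rfl⟩ := h
      have hβJ : ∀ i ∈ J, β i = 0 := fun i hi => hβ0 i (by rwa [mem_block.1 hi])
      set p : ι → Polynomial K := fun i =>
        ∏ k ∈ Finset.range (m i), (Polynomial.X - Polynomial.C (a i k)) with hp
      have hpd : ∀ i, (p i).natDegree < m i + 1 := fun i => by
        rw [hp, Polynomial.natDegree_finsetProd_X_sub_C_eq_card, Finset.card_range]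
        omega
      have e1 : ∀ x : ι → K, ∏ i ∈ J, ∏ k ∈ Finset.range (m i), (x i - a i k) =
          ∑ l ∈ Fintype.piFinset fun i => Finset.range (m i + 1),
            (∏ i, (p i).coeff (l i)) * ∏ i, x i ^ l i := by
        intro x
        have : ∀ i, ∏ k ∈ Finset.range (m i), (x i - a i k) = (p i).eval (x i) := fun i => by
          simp [hp, Polynomial.eval_prod]
        rw [Finset.prod_subset (Finset.subset_univ J) fun i _ hi => by simp [hm0 i hi]]
        simp only [this, Polynomial.eval_eq_sum_range' (hpd _), Finset.prod_univ_sum,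
          Finset.prod_mul_distrib]
      have e2 : ∀ x : ι → K, ∏ i, (J.piecewise q x) i ^ β i = ∏ i, x i ^ β i := fun x =>
        Finset.prod_congr rfl fun i _ => by
          by_cases hi : i ∈ J
          · simp [hβJ i hi]
          · simp [hi]
      have e3 : (fun x => (∏ i ∈ J, ∏ k ∈ Finset.range (m i), (x i - a i k)) •
          (∏ i, (J.piecewise q x) i ^ β i) • h (J.piecewise q x)) =
          ∑ l ∈ Fintype.piFinset fun i => Finset.range (m i + 1), (∏ i, (p i).coeff (l i)) •
            fun x => (∏ i, x i ^ (l + β) i) • h (J.piecewise q x) := by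
        funext x
        simp only [Finset.sum_apply, Pi.smul_apply, e1, e2, smul_smul, Pi.add_apply,
          pow_add, Finset.prod_mul_distrib, Finset.sum_mul, Finset.sum_smul, mul_assoc]
      rw [e3]
      refine Submodule.sum_mem _ fun l hl => Submodule.smul_mem _ _ (Submodule.subset_span
        ⟨l + β, fun j' => ?_, fun i hi => ?_, fun x => h (J.piecewise q x), fun x y hxy => ?_, rfl⟩)
      · have hlm : ∀ i, l i ≤ m i := fun i => by
          have := Fintype.mem_piFinset.1 hl i
          rw [Finset.mem_range] at this
          omega
        simp only [Pi.add_apply, Finset.sum_add_distrib]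
        by_cases hjj : j' = j
        · subst hjj
          rw [Finset.sum_eq_zero hβJ, add_zero]
          exact (Finset.sum_le_sum fun i _ => hlm i).trans hmr
        · rw [Finset.sum_eq_zero (f := l), zero_add]
          · exact hβ j'
          · intro i hi
            have h0 := hm0 i fun hi' => hjj ((mem_block.1 hi).symm.trans (mem_block.1 hi'))
            have := hlm i
            omega
      · rw [Finset.mem_insert, not_or] at hi
        have h0 := hm0 i fun hi' => hi.1 (mem_block.1 hi')
        have := Fintype.mem_piFinset.1 hl i
        rw [Finset.mem_range] at this
        rw [Pi.add_apply, hβ0 i hi.2]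
        omega
      · refine hh _ _ fun i hi => ?_
        by_cases hiJ : i ∈ J
        · simp [hiJ]
        · simp only [hiJ, not_false_eq_true, Finset.piecewise_eq_of_notMem]
          refine hxy i fun h' => ?_
          rcases Finset.mem_insert.1 h' with h' | h'
          · exact hiJ (mem_block.2 h')
          · exact hi h'
  have e : newton J (r j) a F = ∑ m ∈ degreesLE J (r j),
      ∑ q ∈ Fintype.piFinset (J.piecewise (initNodes a (m + 1)) fun _ => {0}),
        (∏ i ∈ J, weight (initNodes a (m + 1) i) (q i)) • fun x =>
          (∏ i ∈ J, ∏ k ∈ Finset.range (m i), (x i - a i k)) • F (J.piecewise q x) := by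
    funext x
    simp only [newton, divDiff_piecewise_singleton, Finset.sum_apply, Pi.smul_apply,
      Finset.smul_sum]
    exact Finset.sum_congr rfl fun m _ => Finset.sum_congr rfl fun q _ => smul_comm _ _ _
  rw [e]
  exact Submodule.sum_mem _ fun m hm => Submodule.sum_mem _ fun q _ =>
    Submodule.smul_mem _ _ (key m hm q)

end PartialPolynomials

/-! ### Choice of interpolation nodes in product sets -/

section NodeSystems

variable {ι K : Type*}

/-- `a` is a system of pairwise distinct nodes in the factors of the product set `Q`. -/
def IsNodeSystem (Q : Set (ι → K)) (a : ι → ℕ → K) : Prop :=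
  (∀ i, Function.Injective (a i)) ∧ ∃ v : ι → Set K, Q = univ.pi v ∧ ∀ i k, a i k ∈ v i

/-- The nodes are given in the factors of some product representation of the set. Every choice of
one node per coordinate is a point of the set, which can be projected to `v i`. -/
theorem IsNodeSystem.mem {v : ι → Set K} {a : ι → ℕ → K} (h : IsNodeSystem (univ.pi v) a)
    (i : ι) (k : ℕ) : a i k ∈ v i := by
  obtain ⟨-, w, hw, haw⟩ := h
  have : (fun l => a l (Function.update (fun _ => 0) i k l)) ∈ univ.pi v := by
    rw [hw]
    exact fun l _ => haw l _
  simpa using this i trivial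

theorem IsNodeSystem.piecewise_mem {Q : Set (ι → K)} {a : ι → ℕ → K} (h : IsNodeSystem Q a)
    {J : Finset ι} {q x : ι → K} (hq : ∀ i ∈ J, q i ∈ range (a i)) (hx : x ∈ Q) :
    J.piecewise q x ∈ Q := by
  obtain ⟨-, w, rfl, haw⟩ := h
  intro i _
  by_cases hi : i ∈ J
  · obtain ⟨k, hk⟩ := hq i hi
    simpa [hi, ← hk] using haw i k
  · simpa [hi] using hx i trivial

theorem exists_isNodeSystem [TopologicalSpace K] [T1Space K] {v : ι → Set K}
    (hv : ∀ i, Preperfect (v i)) (hne : ∀ i, (v i).Nonempty) : ∃ a, IsNodeSystem (univ.pi v) a := by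
  have h : ∀ i, ∃ a : ℕ → K, Function.Injective a ∧ ∀ k, a k ∈ v i := by
    intro i
    obtain ⟨x, hx⟩ := hne i
    have hinf : (v i).Infinite := Set.Infinite.of_accPt (hv i x hx)
    exact ⟨fun k => hinf.natEmbedding _ k,
      Subtype.val_injective.comp (hinf.natEmbedding _).injective,
      fun k => (hinf.natEmbedding _ k).2⟩
  choose a ha hav using h
  exact ⟨a, ha, v, rfl, hav⟩

end NodeSystems

/-! ### Cellwise interpolation -/

section Cells

variable {ι K E : Type*} [NormedField K]

/-- The polydisc of radii `‖d i‖` around `x`. -/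
def cell (d x : ι → K) : Set (ι → K) := {y | ∀ i, ‖y i - x i‖ ≤ ‖d i‖}

theorem cell_subset_cell {d d' : ι → K} (h : ∀ i, ‖d' i‖ ≤ ‖d i‖) (x : ι → K) :
    cell d' x ⊆ cell d x := fun _ hy i => (hy i).trans (h i)

theorem norm_sub_le_of_norm_sub_le [IsUltrametricDist K] {x y z : K} {ρ : ℝ}
    (hx : ‖x - y‖ ≤ ρ) (hy : ‖y - z‖ ≤ ρ) : ‖x - z‖ ≤ ρ := by
  rw [← sub_add_sub_cancel x y z]
  exact (IsUltrametricDist.norm_add_le_max _ _).trans (max_le hx hy)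

theorem cell_eq_cell [IsUltrametricDist K] {d x y : ι → K} (h : y ∈ cell d x) :
    cell d y = cell d x := by
  ext z
  refine ⟨fun hz i => norm_sub_le_of_norm_sub_le (hz i) (h i), fun hz i => ?_⟩
  refine norm_sub_le_of_norm_sub_le (hz i) ?_
  rw [norm_sub_rev]
  exact h i

theorem cell_mem_nhds [Fintype ι] {d : ι → K} (hd : ∀ i, d i ≠ 0) (x : ι → K) :
    cell d x ∈ 𝓝 x := by
  have : cell d x = univ.pi fun i => Metric.closedBall (x i) ‖d i‖ := by
    ext y
    simp [cell, dist_eq_norm]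
  rw [this]
  exact set_pi_mem_nhds finite_univ fun i _ =>
    Metric.closedBall_mem_nhds _ (norm_pos_iff.2 (hd i))

variable [Fintype ι] [AddCommGroup E] [Module K E]

/-- Newton interpolation with nodes chosen in `Q`, and `0` if there are no nodes. -/
def newtonOn (Q : Set (ι → K)) (J : Finset ι) (r : ℕ) (F : (ι → K) → E) (x : ι → K) : E :=
  if h : ∃ a, IsNodeSystem Q a then newton J r h.choose F x else 0

/-- Newton interpolation with nodes chosen separately on each cell. -/
def cellNewton (U : Set (ι → K)) (J : Finset ι) (r : ℕ) (d : ι → K) (F : (ι → K) → E)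
    (x : ι → K) : E := newtonOn (U ∩ cell d x) J r F x

theorem cellNewton_eq [IsUltrametricDist K] {U : Set (ι → K)} {J : Finset ι} {r : ℕ} {d : ι → K}
    {F : (ι → K) → E} {x y : ι → K} (h : y ∈ cell d x) :
    cellNewton U J r d F y = newtonOn (U ∩ cell d x) J r F y := by
  rw [cellNewton, cell_eq_cell h]

/-- Cells are neighbourhoods of each of their points, so locally a single choice of nodes is in
force. -/
theorem hasDiagLim_cellNewton [IsUltrametricDist K] [TopologicalSpace E] [ContinuousAdd E]
    [ContinuousSMul K E] {U : Set (ι → K)} {N : Set (ι → ℕ)} (hN : IsLowerSet N)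
    {F : (ι → K) → E} (hF : ∀ z ∈ U, ∀ γ ∈ N, HasDiagLim U γ F z) (J : Finset ι) (r : ℕ)
    {d : ι → K} (hd : ∀ i, d i ≠ 0) :
    ∀ x ∈ U, ∀ γ ∈ N, HasDiagLim U γ (cellNewton U J r d F) x := by
  intro x hx γ hγ
  have hmem : cell d x ∈ 𝓝[U] x := mem_nhdsWithin_of_mem_nhds (cell_mem_nhds hd x)
  have h1 : ∀ᶠ z in 𝓝[U] x, newtonOn (U ∩ cell d x) J r F z = cellNewton U J r d F z := by
    filter_upwards [hmem] with z hz
    exact (cellNewton_eq hz).symm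
  refine HasDiagLim.congr ?_ h1
  by_cases h : ∃ a, IsNodeSystem (U ∩ cell d x) a
  · refine (hasDiagLim_newton hN hF hx (J := J) r (a := h.choose) (fun q hq => ?_) γ hγ).congr
      (Filter.Eventually.of_forall fun z => ?_)
    · filter_upwards [self_mem_nhdsWithin, hmem] with z hzU hz
      exact (h.choose_spec.piecewise_mem hq ⟨hzU, hz⟩).1
    · rw [newtonOn, dif_pos h]
  · refine (HasDiagLim.const U γ (0 : E) x).congr (Filter.Eventually.of_forall fun z => ?_)
    rw [newtonOn, dif_neg h]

theorem exists_mem_polySpan_eqOn_cellNewton [IsUltrametricDist K] {τ : Type*} {b : ι → τ}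
    {r : τ → ℕ} {S : Finset τ} {j : τ} (hj : j ∉ S) {U : Set (ι → K)} {F : (ι → K) → E}
    {d d' : ι → K} (hd : ∀ i, ‖d' i‖ ≤ ‖d i‖) {x : ι → K}
    (hF : ∃ P ∈ polySpan K E b r S, ∀ y ∈ U ∩ cell d x, F y = P y) :
    ∃ P ∈ polySpan K E b r (insert j S), ∀ y ∈ U ∩ cell d' x,
      cellNewton U (block b j) (r j) d' F y = P y := by
  obtain ⟨P, hP, hFP⟩ := hF
  by_cases h : ∃ a, IsNodeSystem (U ∩ cell d' x) a
  · refine ⟨_, newton_mem_polySpan hj h.choose hP, fun y hy => ?_⟩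
    rw [cellNewton_eq hy.2, newtonOn, dif_pos h]
    refine Finset.sum_congr rfl fun m _ => ?_
    congr 1
    refine divDiff_congr fun z hz => hFP z ?_
    have hz' := Fintype.mem_piFinset.1 hz
    have e : (block b j).piecewise z y = z := by
      funext i
      have := hz' i
      by_cases hi : i ∈ block b j <;> simp_all
    rw [← e]
    -- The grid points stay in the finer cell, hence in the coarser one where F agrees with P.
    refine inter_subset_inter_right U (cell_subset_cell hd x)
      (h.choose_spec.piecewise_mem (fun i hi => ?_) hy)
    have := hz' i
    simp only [hi, Finset.piecewise_eq_of_mem, initNodes, Finset.mem_image] at this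
    obtain ⟨k, -, hk⟩ := this
    exact ⟨k, hk⟩
  · refine ⟨0, Submodule.zero_mem _, fun y hy => ?_⟩
    rw [cellNewton_eq hy.2, newtonOn, dif_neg h]
    rfl

end Cells

/-! ### Approximation by interpolation in one block -/

section Approximation

theorem exists_pos_le {σ : Type*} [Finite σ] {ρ : σ → ℝ} (h : ∀ k, 0 < ρ k) :
    ∃ ε > 0, ∀ k, ε ≤ ρ k := by
  have h1 : ∀ᶠ ε in 𝓝[>] (0 : ℝ), ∀ k, ε ≤ ρ k :=
    Filter.eventually_all.2 fun k => by
      filter_upwards [Ioc_mem_nhdsGT (h k)] with ε hε using hε.2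
  obtain ⟨ε, hε, hpos⟩ := (h1.and self_mem_nhdsWithin).exists
  exact ⟨ε, hpos, hε⟩

variable {ι K E : Type*} [Fintype ι] [NormedField K] [AddCommGroup E] [Module K E]

/-- The divided differences of `G` of order `γ` with nodes in `v` and close to `C` lie in `W`. -/
def SmallOn (G : (ι → K) → E) (γ : ι → ℕ) (v C : ι → Set K) (W : AddSubgroup E) : Prop :=
  ∃ ρ > 0, ∀ s : ι → Finset K, (∀ i, (s i).card = γ i + 1) → (∀ i, (s i : Set K) ⊆ v i) →
    (∀ i, ∀ x ∈ s i, ∃ c ∈ C i, ‖x - c‖ < ρ) → divDiff G s ∈ W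

theorem SmallOn.add {F G : (ι → K) → E} {γ : ι → ℕ} {v C : ι → Set K} {W : AddSubgroup E}
    (hF : SmallOn F γ v C W) (hG : SmallOn G γ v C W) :
    SmallOn (fun x => F x + G x) γ v C W := by
  obtain ⟨ρ, hρ, hF⟩ := hF
  obtain ⟨ρ', hρ', hG⟩ := hG
  refine ⟨min ρ ρ', lt_min hρ hρ', fun s h1 h2 h3 => ?_⟩
  rw [divDiff_add]
  refine W.add_mem (hF s h1 h2 fun i x hx => ?_) (hG s h1 h2 fun i x hx => ?_)
  · obtain ⟨c, hc, hlt⟩ := h3 i x hx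
    exact ⟨c, hc, hlt.trans_le (min_le_left _ _)⟩
  · obtain ⟨c, hc, hlt⟩ := h3 i x hx
    exact ⟨c, hc, hlt.trans_le (min_le_right _ _)⟩

variable [IsUltrametricDist K] [TopologicalSpace E] [IsTopologicalAddGroup E]
  [ContinuousSMul K E] [T2Space E]

/-- On fine cells, cellwise Newton interpolation in one block of variables approximates `F`. -/
theorem exists_smallOn_sub_cellNewton {τ : Type*} {b : ι → τ} {r : τ → ℕ} (j : τ)
    {U : Set (ι → K)} {F : (ι → K) → E} (hF : ∀ x ∈ U, ∀ γ ∈ blockDegLE b r, HasDiagLim U γ F x)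
    {d : ι → K} (hd : ∀ i, d i ≠ 0 ∧ ‖d i‖ ≤ 1) {γ : ι → ℕ} (hγ : γ ∈ blockDegLE b r)
    {v C : ι → Set K} (hvp : ∀ i, Preperfect (v i))
    (hvU : ∃ O, IsOpen O ∧ univ.pi v = U ∩ O) (hC : ∀ i, IsCompact (C i))
    (hCv : ∀ i, C i ⊆ v i) (hcell : ∀ c ∈ univ.pi C, U ∩ cell d c ⊆ univ.pi v)
    {W : AddSubgroup E} (hWo : IsOpen (W : Set E))
    (hW : ∀ c : K, ‖c‖ ≤ 1 → ∀ w ∈ W, c • w ∈ W) :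
    ∃ ρ > 0, ∀ δ : K, δ ≠ 0 → ‖δ‖ < ρ → ‖δ‖ ≤ 1 → (∀ i, ‖δ‖ ≤ ‖d i‖) →
      SmallOn (fun x => F x - cellNewton U (block b j) (r j)
        ((block b j).piecewise (fun _ => δ) d) F x) γ v C W := by
  set J := block b j with hJ
  have hV : IsOpenCartesianIn (univ.pi v) U := ⟨hvU, v, hvp, rfl⟩
  have hN := isLowerSet_blockDegLE b r
  -- Bounds the loss from the variables outside J. It does not depend on δ, so W can be replaced by
  -- W' = eW before δ is chosen.
  set e : K := ∏ i ∈ Jᶜ, d i ^ γ i with he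
  have he0 : e ≠ 0 := Finset.prod_ne_zero_iff.2 fun i _ => pow_ne_zero _ (hd i).1
  set W' : AddSubgroup E := W.comap (DistribSMul.toAddMonoidHom E e⁻¹) with hW'
  have hW'o : IsOpen (W' : Set E) := hWo.preimage (continuous_const_smul e⁻¹)
  have hW's : ∀ c : K, ‖c‖ ≤ 1 → ∀ w ∈ W', c • w ∈ W' := by
    intro c hc w hw
    change e⁻¹ • c • w ∈ W
    rw [smul_comm]
    exact hW c hc _ hw
  have huc := fun γ' : blockDegLE b r => exists_divDiff_sub_divDiff_mem
    (hasExt_of_hasDiagLim hV fun x hx γ'' h => hF x (hV.subset hx) γ'' (hN h γ'.2)) hC hCv hW'o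
  choose ρ hρ huc using huc
  have := (finite_blockDegLE b r).to_subtype
  obtain ⟨ρ₀, hρ₀, hρle⟩ := exists_pos_le hρ
  refine ⟨ρ₀, hρ₀, fun δ hδ hδρ hδ1 hδd => ?_⟩
  set d' : ι → K := J.piecewise (fun _ => δ) d with hd'
  have hd'J : ∀ i ∈ J, d' i = δ := fun i hi => by simp [hd', hi]
  have hd'n : ∀ i ∉ J, d' i = d i := fun i hi => by simp [hd', hi]
  have hd'd : ∀ i, ‖d' i‖ ≤ ‖d i‖ := fun i => by
    by_cases hi : i ∈ J
    · rw [hd'J i hi]; exact hδd i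
    · rw [hd'n i hi]
  have hd'0 : ∀ i, d' i ≠ 0 := fun i => by
    by_cases hi : i ∈ J
    · rwa [hd'J i hi]
    · rw [hd'n i hi]; exact (hd i).1
  -- Nodes within ρ₁ of C lie in a cell centred at a point of C, where U is a product set and nodes
  -- are available.
  obtain ⟨ρ₁, hρ₁, hρ₁d⟩ := exists_pos_le fun i => norm_pos_iff.2 (hd'0 i)
  refine ⟨min ρ₀ ρ₁, lt_min hρ₀ hρ₁, fun s hsc hsv hsC => ?_⟩
  have hsne : ∀ i, (s i).Nonempty := fun i => Finset.card_pos.1 (by rw [hsc i]; omega)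
  have hglue := inv_smul_divDiff_mem_of_forall_cell (F := fun x => F x - cellNewton U J (r j) d' F x)
    hW hd'0 s hsne 1 fun t hts htd => ?_
  · simpa using hglue
  choose x hx using fun i => (hts i).2
  choose c hcC hcx using fun i => hsC i (x i) ((hts i).1 (hx i))
  have htc : ∀ i, ∀ y ∈ t i, ‖y - c i‖ ≤ ‖d' i‖ := fun i y hy =>
    norm_sub_le_of_norm_sub_le (htd i y hy (x i) (hx i))
      ((hcx i).le.trans ((min_le_right _ _).trans (hρ₁d i)))
  have hcv : c ∈ univ.pi v := fun i _ => hCv i (hcC i)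
  have hQ : U ∩ cell d' c = univ.pi fun i => v i ∩ Metric.closedBall (c i) ‖d' i‖ := by
    ext y
    constructor
    · intro hy i _
      refine ⟨hcell c (fun i _ => hcC i) ⟨hy.1, cell_subset_cell hd'd c hy.2⟩ i trivial, ?_⟩
      rw [Metric.mem_closedBall, dist_eq_norm]
      exact hy.2 i
    · intro hy
      refine ⟨hV.subset fun i _ => (hy i trivial).1, fun i => ?_⟩
      rw [← dist_eq_norm]
      exact (hy i trivial).2
  have hex : ∃ a, IsNodeSystem (U ∩ cell d' c) a := by
    rw [hQ]
    refine exists_isNodeSystem (fun i => ?_) fun i => ⟨c i, hCv i (hcC i),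
      Metric.mem_closedBall_self (norm_nonneg _)⟩
    rw [inter_comm]
    exact (hvp i).open_inter (IsUltrametricDist.isOpen_closedBall _ (norm_ne_zero_iff.2 (hd'0 i)))
  obtain ⟨a, haeq, ha⟩ : ∃ a, (∀ F : (ι → K) → E, ∀ y,
      newtonOn (U ∩ cell d' c) J (r j) F y = newton J (r j) a F y) ∧
      IsNodeSystem (U ∩ cell d' c) a :=
    ⟨hex.choose, fun F y => by rw [newtonOn, dif_pos hex], hex.choose_spec⟩
  have hain := ha.1
  rw [hQ] at ha
  have e1 : divDiff (fun x => F x - cellNewton U J (r j) d' F x) t =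
      divDiff (fun x => F x - newton J (r j) a F x) t := by
    refine divDiff_congr fun z hz => ?_
    rw [cellNewton_eq fun i => htc i _ (Fintype.mem_piFinset.1 hz i), haeq]
  have hcard : ∀ i, (t i).card - 1 ≤ γ i := fun i => by
    have := Finset.card_le_card (hts i).1
    rw [hsc i] at this
    omega
  have hsum : ∑ i ∈ J, ((t i).card - 1) ≤ r j :=
    (Finset.sum_le_sum fun i _ => hcard i).trans (hγ j)
  have hest := inv_pow_smul_divDiff_sub_newton_mem (J := J) (r := r j) (a := a) (F := F) hW's hδ
    (B := fun i => v i ∩ Metric.closedBall (c i) ‖δ‖) (T := t)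
    (fun i hi y hy z hz => by
      have h1 := Metric.mem_closedBall.1 hy.2
      have h2 := Metric.mem_closedBall.1 hz.2
      rw [dist_eq_norm] at h1
      rw [dist_comm, dist_eq_norm] at h2
      exact norm_sub_le_of_norm_sub_le h1 h2)
    (fun i _ => hain i) (fun i hi k => by
      have := ha.mem i k
      rwa [hd'J i hi] at this)
    (fun t₁ t₂ hT hB hr => ?_) (r j - ∑ i ∈ J, ((t i).card - 1)) t (fun _ _ => rfl)
    (fun i hi => ⟨fun y hy => ⟨hsv i ((hts i).1 hy), ?_⟩, (hts i).2⟩) (by omega)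
  rotate_left
  · have hne : ∀ i, (t₁ i).Nonempty := fun i => by
      by_cases hi : i ∈ J
      · exact (hB i hi).2.2.2
      · rw [(hT i hi).1]; exact (hts i).2
    have hγ₁ : (fun i => (t₁ i).card - 1) ∈ blockDegLE b r := by
      intro j'
      by_cases hjj : j' = j
      · subst hjj; exact hr.le
      · refine (Finset.sum_le_sum fun i hi => ?_).trans (hγ j')
        rw [(hT i fun hi' => hjj ((mem_block.1 hi).symm.trans (mem_block.1 hi'))).1]
        exact hcard i
    have hρ' := hρle ⟨_, hγ₁⟩
    refine huc ⟨_, hγ₁⟩ t₁ t₂ (fun i => ?_) (fun i => ?_) fun i => ?_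
    · have hpos := Finset.card_pos.2 (hne i)
      have h12 : (t₂ i).card = (t₁ i).card := by
        by_cases hi : i ∈ J
        · exact (hB i hi).2.2.1.symm
        · rw [(hT i hi).1, (hT i hi).2]
      rw [h12]
      refine ⟨?_, ?_⟩ <;> simp only <;> omega
    · by_cases hi : i ∈ J
      · exact ⟨(hB i hi).1.trans inter_subset_left, (hB i hi).2.1.trans inter_subset_left⟩
      · rw [(hT i hi).1, (hT i hi).2]
        have := (Finset.coe_subset.2 (hts i).1).trans (hsv i)
        exact ⟨this, this⟩
    · by_cases hi : i ∈ J
      · refine Or.inr ⟨c i, hcC i, fun y hy => ?_⟩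
        rw [← dist_eq_norm]
        refine lt_of_le_of_lt ?_ (hδρ.trans_le hρ')
        rcases hy with hy | hy
        · exact ((hB i hi).1 hy).2
        · exact ((hB i hi).2.1 hy).2
      · rw [(hT i hi).1, (hT i hi).2]
        refine Or.inl ⟨rfl, fun y hy => ?_⟩
        obtain ⟨c', hc', hlt⟩ := hsC i y ((hts i).1 hy)
        exact ⟨c', hc', hlt.trans_le ((min_le_left _ _).trans hρ')⟩
  · rw [Metric.mem_closedBall, dist_eq_norm, ← hd'J i hi]
    exact htc i y hy
  rw [e1]
  set k := r j - ∑ i ∈ J, ((t i).card - 1) with hk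
  set D := divDiff (fun x => F x - newton J (r j) a F x) t with hD
  have hest' : e⁻¹ • (δ ^ k)⁻¹ • D ∈ W := hest
  set p : K := ∏ i, d' i ^ ((s i).card - (t i).card) with hp
  have hp0 : p ≠ 0 := Finset.prod_ne_zero_iff.2 fun i _ => pow_ne_zero _ (hd'0 i)
  -- Gain against loss: ‖e δ^k‖ ≤ ‖p‖. In J at most k nodes are removed, where k is the defect of
  -- the order of t from r j; outside J at most γ i nodes are removed in direction i.
  have e2 : (1 * p)⁻¹ • D = (e * δ ^ k / p) • e⁻¹ • (δ ^ k)⁻¹ • D := by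
    rw [smul_smul, smul_smul]
    congr 1
    field_simp
  rw [e2]
  refine hW _ ?_ _ hest'
  rw [norm_div]
  refine div_le_one_of_le₀ ?_ (norm_nonneg _)
  rw [hp, ← Finset.prod_mul_prod_compl J, norm_mul, norm_mul, mul_comm]
  refine mul_le_mul ?_ ?_ (norm_nonneg _) (norm_nonneg _)
  · rw [Finset.prod_congr rfl fun i hi => by rw [hd'J i hi], Finset.prod_pow_eq_pow_sum, norm_pow,
      norm_pow]
    refine pow_le_pow_of_le_one (norm_nonneg _) hδ1 ?_
    have h1 : ∑ i ∈ J, ((s i).card - (t i).card) + ∑ i ∈ J, ((t i).card - 1) ≤ ∑ i ∈ J, γ i := by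
      rw [← Finset.sum_add_distrib]
      refine Finset.sum_le_sum fun i _ => ?_
      have := Finset.card_pos.2 (hts i).2
      have := Finset.card_le_card (hts i).1
      have := hsc i
      omega
    have h2 : ∑ i ∈ J, γ i ≤ r j := hγ j
    omega
  · rw [he, norm_prod, norm_prod]
    refine Finset.prod_le_prod (fun i _ => norm_nonneg _) fun i hi => ?_
    rw [hd'n i (Finset.mem_compl.1 hi), norm_pow, norm_pow]
    refine pow_le_pow_of_le_one (norm_nonneg _) (hd i).2 ?_
    have := Finset.card_pos.2 (hts i).2
    have := hsc i
    omega

end Approximation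

/-! ### Iteration over the blocks -/

section Iteration

variable {ι K E : Type*} [Fintype ι] [NontriviallyNormedField K] [IsUltrametricDist K]
  [AddCommGroup E] [Module K E] [TopologicalSpace E] [IsTopologicalAddGroup E]
  [ContinuousSMul K E] [T2Space E]

/-- A function with limits of divided differences can be approximated by locally polynomial ones,
with respect to finitely many conditions. -/
theorem exists_locally_polynomial_smallOn {τ : Type*} [Fintype τ] {b : ι → τ} {r : τ → ℕ}
    {U : Set (ι → K)} {F : (ι → K) → E} (hF : ∀ x ∈ U, ∀ γ ∈ blockDegLE b r, HasDiagLim U γ F x)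
    {σ : Type*} [Finite σ] {γ : σ → ι → ℕ} (hγ : ∀ k, γ k ∈ blockDegLE b r)
    {v C : σ → ι → Set K} (hvp : ∀ k i, Preperfect (v k i))
    (hvU : ∀ k, ∃ O, IsOpen O ∧ univ.pi (v k) = U ∩ O) (hC : ∀ k i, IsCompact (C k i))
    (hCv : ∀ k i, C k i ⊆ v k i) {W : σ → AddSubgroup E} (hWo : ∀ k, IsOpen (W k : Set E))
    (hW : ∀ k, ∀ c : K, ‖c‖ ≤ 1 → ∀ w ∈ W k, c • w ∈ W k) :
    ∃ (G : (ι → K) → E) (d : ι → K), (∀ i, d i ≠ 0) ∧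
      (∀ x ∈ U, ∃ a : (ι → ℕ) →₀ E, (∀ β, a β ≠ 0 → β ∈ blockDegLE b r) ∧
        ∀ y ∈ U ∩ cell d x, G y = a.sum fun β c => (∏ i, y i ^ β i) • c) ∧
      ∀ k, SmallOn (fun x => F x - G x) (γ k) (v k) (C k) (W k) := by
  have key : ∀ S : Finset τ, ∃ (G : (ι → K) → E) (d : ι → K),
      (∀ x ∈ U, ∀ γ ∈ blockDegLE b r, HasDiagLim U γ G x) ∧ (∀ i, d i ≠ 0 ∧ ‖d i‖ ≤ 1) ∧
      (∀ x ∈ U, ∃ P ∈ polySpan K E b r S, ∀ y ∈ U ∩ cell d x, G y = P y) ∧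
      (∀ k, SmallOn (fun x => F x - G x) (γ k) (v k) (C k) (W k)) ∧
      ∀ k, ∀ c ∈ univ.pi (C k), U ∩ cell d c ⊆ univ.pi (v k) := by
    intro S
    induction S using Finset.induction_on with
    | empty =>
      have h1 : ∀ k, ∃ ρ > 0, ∀ c ∈ univ.pi (C k), U ∩ Metric.ball c ρ ⊆ univ.pi (v k) := by
        intro k
        obtain ⟨O, hO, hvO⟩ := hvU k
        obtain ⟨ρ, hρ, hsub⟩ := (isCompact_univ_pi (hC k)).exists_thickening_subset_open hO
          (fun c hc => (hvO.subset fun i _ => hCv k i (hc i trivial)).2)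
        refine ⟨ρ, hρ, fun c hc y hy => ?_⟩
        rw [hvO]
        exact ⟨hy.1, hsub (Metric.mem_thickening_iff.2 ⟨c, hc, hy.2⟩)⟩
      choose ρ hρ hball using h1
      obtain ⟨ε, hε, hερ⟩ := exists_pos_le hρ
      -- The initial cells are so small that around points of the compact sets they stay inside the
      -- given cartesian sets; later cells only shrink.
      obtain ⟨δ, hδ0, hδ⟩ := NormedField.exists_norm_lt K (lt_min hε one_pos)
      refine ⟨F, fun _ => δ, hF, fun i => ⟨norm_pos_iff.1 hδ0, (hδ.trans_le (min_le_right _ _)).le⟩,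
        fun x _ => ⟨F, mem_polySpan_empty b r F, fun _ _ => rfl⟩, fun k => ⟨1, one_pos, fun s _ _ _ =>
        ?_⟩, fun k c hc y hy => hball k c hc ⟨hy.1, ?_⟩⟩
      · rw [divDiff_sub, sub_self]
        exact (W k).zero_mem
      · rw [Metric.mem_ball, dist_pi_lt_iff (hρ k)]
        intro i
        rw [dist_eq_norm]
        exact (hy.2 i).trans_lt (hδ.trans_le ((min_le_left _ _).trans (hερ k)))
    | insert j S hj ih =>
      obtain ⟨G, d, hG, hd, hP, hS, hcell⟩ := ih
      choose ρ hρ hstep using fun k => exists_smallOn_sub_cellNewton j hG hd (hγ k) (hvp k) (hvU k)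
        (hC k) (hCv k) (hcell k) (hWo k) (hW k)
      obtain ⟨ε, hε, hερ⟩ := exists_pos_le hρ
      obtain ⟨ε', hε', hεd⟩ := exists_pos_le fun i => norm_pos_iff.2 (hd i).1
      obtain ⟨δ, hδ0, hδ⟩ := NormedField.exists_norm_lt K (lt_min (lt_min hε hε') one_pos)
      have hδ1 : ‖δ‖ ≤ 1 := (hδ.trans_le (min_le_right _ _)).le
      have hδε : ‖δ‖ < ε := hδ.trans_le ((min_le_left _ _).trans (min_le_left _ _))
      have hδd : ∀ i, ‖δ‖ ≤ ‖d i‖ := fun i =>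
        (hδ.trans_le ((min_le_left _ _).trans (min_le_right _ _))).le.trans (hεd i)
      set d' : ι → K := (block b j).piecewise (fun _ => δ) d with hd'
      have hd1 : ∀ i, d' i ≠ 0 ∧ ‖d' i‖ ≤ 1 ∧ ‖d' i‖ ≤ ‖d i‖ := fun i => by
        by_cases hi : i ∈ block b j
        · simpa [hd', hi] using ⟨norm_pos_iff.1 hδ0, hδ1, hδd i⟩
        · simpa [hd', hi] using hd i
      refine ⟨cellNewton U (block b j) (r j) d' G, d',
        hasDiagLim_cellNewton (isLowerSet_blockDegLE b r) hG _ _ fun i => (hd1 i).1,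
        fun i => ⟨(hd1 i).1, (hd1 i).2.1⟩, fun x hx =>
        exists_mem_polySpan_eqOn_cellNewton hj (fun i => (hd1 i).2.2) (hP x hx), fun k => ?_,
        fun k c hc => (inter_subset_inter_right U (cell_subset_cell (fun i => (hd1 i).2.2) c)).trans
          (hcell k c hc)⟩
      -- The errors of successive steps add up inside the same W, since W is a subgroup.
      have := (hS k).add (hstep k δ (norm_pos_iff.1 hδ0) (hδε.trans_le (hερ k)) hδ1 hδd)
      simpa only [sub_add_sub_cancel] using this
  obtain ⟨G, d, -, hd, hP, hS, -⟩ := key Finset.univ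
  refine ⟨G, d, fun i => (hd i).1, fun x hx => ?_, hS⟩
  obtain ⟨P, hPm, hGP⟩ := hP x hx
  obtain ⟨a, ha, haP⟩ := exists_finsupp_of_mem_polySpan (fun i => Finset.mem_univ (b i)) hPm
  exact ⟨a, ha, fun y hy => (hGP y hy).trans (haP y)⟩

end Iteration

/-! ### The spaces C^α(U, E) and their topology -/

section BlockSpaces

variable {ℓ : ℕ} {n : Fin ℓ → ℕ}

theorem sum_block_fst (γ : (Σ j, Fin (n j)) → ℕ) (j : Fin ℓ) :
    ∑ i ∈ block Sigma.fst j, γ i = ∑ i, γ ⟨j, i⟩ := by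
  have : block Sigma.fst j =
      Finset.univ.map (Function.Embedding.sigmaMk (β := fun j => Fin (n j)) j) := by
    ext ⟨k, i⟩
    simp only [mem_block, Finset.mem_map, Finset.mem_univ, true_and]
    constructor
    · rintro rfl
      exact ⟨i, rfl⟩
    · rintro ⟨a, ha⟩
      exact (congrArg Sigma.fst ha).symm
  rw [this, Finset.sum_map]
  rfl

theorem mem_blockDegLE_fst {γ : (Σ j, Fin (n j)) → ℕ} {r : Fin ℓ → ℕ} :
    γ ∈ blockDegLE Sigma.fst r ↔ ∀ j, ∑ i, γ ⟨j, i⟩ ≤ r j :=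
  forall_congr' fun j => by rw [sum_block_fst]

theorem isLowerSet_N (α : Fin ℓ → ℕ∞) : IsLowerSet (N (n := n) α) := fun _ _ h hγ j =>
  (Nat.cast_le.2 (Finset.sum_le_sum fun i _ => h ⟨j, i⟩)).trans (hγ j)

variable {K E : Type*}

theorem SmallOn.congr {ι : Type*} [Fintype ι] [NormedField K] [AddCommGroup E] [Module K E]
    {F G : (ι → K) → E} {γ : ι → ℕ} {v C : ι → Set K} {W : AddSubgroup E}
    (hF : SmallOn F γ v C W) (h : ∀ x ∈ univ.pi v, F x = G x) : SmallOn G γ v C W := by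
  obtain ⟨ρ, hρ, hF⟩ := hF
  refine ⟨ρ, hρ, fun s h1 h2 h3 => ?_⟩
  rw [← divDiff_congr fun x hx => h x fun i _ => h2 i (Fintype.mem_piFinset.1 hx i)]
  exact hF s h1 h2 h3

/-- The extension of `f : U → E` by `0`. -/
def extendZero {X : Type*} [Zero E] {U : Set X} (f : U → E) (x : X) : E :=
  if h : x ∈ U then f ⟨x, h⟩ else 0

theorem extendZero_apply {X : Type*} [Zero E] {U : Set X} (f : U → E) (u : U) :
    extendZero f u = f u := dif_pos u.2

theorem extendZero_of_mem {X : Type*} [Zero E] {U : Set X} (f : U → E) {x : X} (hx : x ∈ U) :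
    extendZero f x = f ⟨x, hx⟩ := dif_pos hx

variable [NormedField K] [AddCommGroup E] [Module K E] [TopologicalSpace E]

theorem exists_open_addSubgroup [IsUltrametricDist K] (hE : IsLocallyConvex K E) {O : Set E}
    (hO : O ∈ 𝓝 (0 : E)) : ∃ W : AddSubgroup E, IsOpen (W : Set E) ∧
      (∀ c : K, ‖c‖ ≤ 1 → ∀ w ∈ W, c • w ∈ W) ∧ (W : Set E) ⊆ O := by
  obtain ⟨W, hW, hWO⟩ := hE.mem_iff.1 hO
  exact ⟨W.toAddSubgroup, hW, fun c hc w hw =>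
    W.smul_mem (⟨c, hc⟩ : (NormedField.valuation (K := K)).integer) hw, hWO⟩

variable [IsTopologicalAddGroup E]

/-- Every subbasic neighbourhood of `f` contains all functions which satisfy a suitable condition
`SmallOn` relative to `f`. -/
theorem exists_smallOn_subset {α : Fin ℓ → ℕ∞} {U : Set ((Σ j, Fin (n j)) → K)}
    {β γ : (Σ j, Fin (n j)) → ℕ} (hβ : β ∈ N α) {V : Set ((Σ j, Fin (n j)) → K)}
    (hV : IsOpenCartesianIn V U) (hγ : ∀ i, (γ i : ℕ∞) ≤ β i) (f : BlockCSpace U E α)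
    {L : Set (extDom V γ)} (hL : IsCompact L) {O : Set E} (hO : IsOpen O)
    (hf : MapsTo (Δ hV hγ (incl hβ f)) L O) {B : AddSubgroup E → Prop}
    (hB : ∀ O ∈ 𝓝 (0 : E), ∃ W : AddSubgroup E, IsOpen (W : Set E) ∧ B W ∧ (W : Set E) ⊆ O) :
    ∃ (v C : (Σ j, Fin (n j)) → Set K) (W : AddSubgroup E), (∀ i, Preperfect (v i)) ∧
      (∃ O, IsOpen O ∧ univ.pi v = U ∩ O) ∧ (∀ i, IsCompact (C i)) ∧ (∀ i, C i ⊆ v i) ∧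
      IsOpen (W : Set E) ∧ B W ∧ ∀ p : BlockCSpace U E α,
        SmallOn (fun x => extendZero f.toFun x - extendZero p.toFun x) γ v C W →
          MapsTo (Δ hV hγ (incl hβ p)) L O := by
  obtain ⟨v, hv, rfl⟩ := hV.2
  obtain ⟨O', hO', hsub⟩ := compact_open_separated_add_right
    (hL.image (Δ hV hγ (incl hβ f)).continuous) hO hf.image_subset
  obtain ⟨W, hWo, hBW, hWO⟩ := hB O' hO'
  refine ⟨v, fun i => ⋃ k, (fun z : extDom (univ.pi v) γ => z.1 i k) '' L, W, hv, hV.1,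
    fun i => isCompact_iUnion fun k => hL.image
      ((continuous_apply k).comp ((continuous_apply i).comp continuous_subtype_val)),
    fun i => ?_, hWo, hBW, fun p hp z hz => ?_⟩
  · refine iUnion_subset fun k => ?_
    rintro _ ⟨z, -, rfl⟩
    simpa using z.2 (Function.update (fun _ => 0) i k) i trivial
  obtain ⟨ρ, hρ, hsmall⟩ := hp
  set g := Δ hV hγ (incl hβ f) with hg
  set g' := Δ hV hγ (incl hβ p) with hg'
  -- The smallness condition concerns distinct nodes only. It reaches z because such points are
  -- dense and W, being an open subgroup, is closed.
  have hmem : g z - g' z ∈ W := by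
    by_contra hnot
    have hZ : IsOpen ({z | g z - g' z ∉ W} ∩ Metric.ball z ρ) := by
      refine IsOpen.inter ?_ Metric.isOpen_ball
      exact (AddSubgroup.isClosed_of_isOpen W hWo).isOpen_compl.preimage
        (g.continuous.sub g'.continuous)
    obtain ⟨y, ⟨hy1, hy2⟩, hy3⟩ := (dense_injective hV.2 γ).inter_open_nonempty _ hZ
      ⟨z, hnot, Metric.mem_ball_self hρ⟩
    refine hy1 ?_
    have e1 : g y = divDiff (extendZero f.toFun) fun i => Finset.univ.image (y.1 i) := by
      rw [hg, Δ_spec hV hγ (incl hβ f) y hy3,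
        diffQuot_restr_eq_divDiff hV.subset (extendZero_apply _) y hy3]
      rfl
    have e2 : g' y = divDiff (extendZero p.toFun) fun i => Finset.univ.image (y.1 i) := by
      rw [hg', Δ_spec hV hγ (incl hβ p) y hy3,
        diffQuot_restr_eq_divDiff hV.subset (extendZero_apply _) y hy3]
      rfl
    rw [e1, e2, ← divDiff_sub]
    refine hsmall _ (fun i => ?_) (fun i x hx => ?_) fun i x hx => ?_
    · rw [Finset.card_image_of_injective _ (hy3 i), Finset.card_univ, Fintype.card_fin]
    · obtain ⟨k, -, rfl⟩ := Finset.mem_image.1 hx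
      simpa using y.2 (Function.update (fun _ => 0) i k) i trivial
    · obtain ⟨k, -, rfl⟩ := Finset.mem_image.1 hx
      refine ⟨z.1 i k, mem_iUnion.2 ⟨k, z, hz, rfl⟩, ?_⟩
      rw [← dist_eq_norm]
      rw [Metric.mem_ball, Subtype.dist_eq, dist_pi_lt_iff hρ] at hy2
      exact (dist_pi_lt_iff hρ).1 (hy2 i) k
  rw [← sub_sub_cancel (g z) (g' z), sub_eq_add_neg]
  exact hsub (add_mem_add (mem_image_of_mem _ hz) (hWO (W.neg_mem hmem)))

variable [ContinuousSMul K E] [T2Space E]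

/-- Reduces C^α to a local condition at single points: cartesian neighbourhoods give one direction,
and the fact that N_α is a lower set gives the orders γ' ≤ γ needed for the other. -/
theorem isBlockC_iff_hasDiagLim {α : Fin ℓ → ℕ∞} {U : Set ((Σ j, Fin (n j)) → K)}
    (hU : IsLocallyCartesian U) {f : U → E} :
    IsBlockC U α f ↔ ∀ x ∈ U, ∀ γ ∈ N α, HasDiagLim U γ (extendZero f) x := by
  refine ⟨fun h x hx γ hγ => ?_, fun h β hβ => ?_⟩
  · obtain ⟨V, hV, hxV⟩ := hU x hx
    exact hasDiagLim_of_hasExt hV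
      ((isC_iff_hasExt (extendZero_apply f)).1 (h γ hγ) V hV γ fun _ => le_rfl) hxV
  · refine (isC_iff_hasExt (extendZero_apply f)).2 fun V hV γ hγ => ?_
    refine hasExt_of_hasDiagLim hV fun x hx γ' hγ' => h x (hV.subset hx) γ' (isLowerSet_N α ?_ hβ)
    exact hγ'.trans fun i => Nat.cast_le.1 (hγ i)

theorem isBlockC_of_mem_locPol {α : Fin ℓ → ℕ∞} {U : Set ((Σ j, Fin (n j)) → K)}
    (hU : IsLocallyCartesian U) {f : U → E} (hf : f ∈ LocPol U E α) : IsBlockC U α f := by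
  refine (isBlockC_iff_hasDiagLim hU).2 fun x hx γ _ => ?_
  obtain ⟨V, hV, hxV, a, -, hfa⟩ := hf ⟨x, hx⟩
  have h1 : HasDiagLim U γ (fun z => a.sum fun β c => (∏ i, z i ^ β i) • c) x :=
    HasDiagLim.sum fun β _ => hasDiagLim_monomial U β γ (a β) x
  refine h1.congr ?_
  rw [nhdsWithin_eq_map_subtype_coe hx, Filter.eventually_map]
  filter_upwards [hV.mem_nhds hxV] with z hz
  rw [extendZero_apply, hfa z hz]

end BlockSpaces

/-- The locally polynomial functions are dense in `C^α(U, E)`. -/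
theorem dense_locPol {ℓ : ℕ} {n : Fin ℓ → ℕ} {K E : Type*} [NontriviallyNormedField K]
    [IsUltrametricDist K] [AddCommGroup E] [Module K E] [TopologicalSpace E]
    [IsTopologicalAddGroup E] [ContinuousSMul K E] [T2Space E] (hE : IsLocallyConvex K E)
    (α : Fin ℓ → ℕ∞) {U : Set ((Σ j, Fin (n j)) → K)} (hU : IsLocallyCartesian U) :
    Dense {f : BlockCSpace U E α | f.toFun ∈ LocPol U E α} := by
  intro f
  let I := {k : ((Σ j, Fin (n j)) → ℕ) × ((Σ j, Fin (n j)) → Set K) ×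
    ((Σ j, Fin (n j)) → Set K) × AddSubgroup E // k.1 ∈ N α ∧ (∀ i, Preperfect (k.2.1 i)) ∧
      (∃ O, IsOpen O ∧ univ.pi k.2.1 = U ∩ O) ∧ (∀ i, IsCompact (k.2.2.1 i)) ∧
      (∀ i, k.2.2.1 i ⊆ k.2.1 i) ∧ IsOpen (k.2.2.2 : Set E) ∧
      ∀ c : K, ‖c‖ ≤ 1 → ∀ w ∈ k.2.2.2, c • w ∈ k.2.2.2}
  let A : I → Set (BlockCSpace U E α) := fun k =>
    {p | SmallOn (fun x => extendZero f.toFun x - extendZero p.toFun x) k.1.1 k.1.2.1 k.1.2.2.1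
      k.1.2.2.2}
  -- It suffices to meet finitely many conditions `A k`: they generate a filter at least as fine as
  -- the neighbourhood filter of f.
  have hle : ⨅ k, Filter.principal (A k) ≤ 𝓝 f := by
    rw [nhds_iInf]
    refine le_iInf fun β => ?_
    rw [nhds_iInf]
    refine le_iInf fun hβ => ?_
    rw [nhds_induced, nhds_iInf, Filter.comap_iInf]
    refine le_iInf fun V => ?_
    rw [nhds_iInf, Filter.comap_iInf]
    refine le_iInf fun hV => ?_
    rw [nhds_iInf, Filter.comap_iInf]
    refine le_iInf fun γ => ?_
    rw [nhds_iInf, Filter.comap_iInf]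
    refine le_iInf fun hγ => ?_
    rw [nhds_induced, Filter.comap_comap, ← Filter.tendsto_iff_comap,
      ContinuousMap.tendsto_nhds_compactOpen]
    intro L hL O hO hf
    obtain ⟨v, C, W, hv, hvU, hC, hCv, hWo, hW, hsub⟩ := exists_smallOn_subset hβ hV hγ f hL hO hf
      fun O hO => exists_open_addSubgroup hE hO
    have hγN : γ ∈ N α := isLowerSet_N α (fun i => Nat.cast_le.1 (hγ i)) hβ
    exact Filter.mem_iInf_of_mem (⟨(γ, v, C, W), hγN, hv, hvU, hC, hCv, hWo, hW⟩ : I)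
      (Filter.mem_principal.2 hsub)
  rw [mem_closure_iff_nhds]
  intro O hO
  obtain ⟨t, ht, htO⟩ := (Filter.hasBasis_iInf_principal_finite A).mem_iff.1 (hle hO)
  -- Only finitely many orders occur, so finite degree bounds r j ≤ α j suffice even where α j is
  -- infinite.
  set r : Fin ℓ → ℕ := fun j => ht.toFinset.sup fun k => ∑ i, k.1.1 ⟨j, i⟩ with hr
  have hrα : ∀ j, (r j : ℕ∞) ≤ α j := by
    intro j
    refine Finset.sup_induction (p := fun m : ℕ => (m : ℕ∞) ≤ α j) (by simp) ?_ ?_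
    · intro a ha b hb
      rcases le_total a b with h | h
      · rwa [sup_eq_right.2 h]
      · rwa [sup_eq_left.2 h]
    · exact fun k _ => k.2.1 j
  have hrN : ∀ γ ∈ blockDegLE Sigma.fst r, γ ∈ N (n := n) α := fun γ hγ j =>
    (Nat.cast_le.2 (mem_blockDegLE_fst.1 hγ j)).trans (hrα j)
  have := ht.to_subtype
  obtain ⟨G, d, hd, hG, hsmall⟩ := exists_locally_polynomial_smallOn (b := Sigma.fst) (r := r)
    (F := extendZero f.toFun) (σ := t) (γ := fun k => k.1.1.1) (v := fun k => k.1.1.2.1)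
    (C := fun k => k.1.1.2.2.1) (W := fun k => k.1.1.2.2.2)
    (fun x hx γ hγ => (isBlockC_iff_hasDiagLim hU).1 f.isBlockC x hx γ (hrN γ hγ))
    (fun k => mem_blockDegLE_fst.2 fun j =>
      Finset.le_sup (f := fun k : I => ∑ i, k.1.1 ⟨j, i⟩) (ht.mem_toFinset.2 k.2))
    (fun k => k.1.2.2.1) (fun k => k.1.2.2.2.1) (fun k => k.1.2.2.2.2.1)
    (fun k => k.1.2.2.2.2.2.1) (fun k => k.1.2.2.2.2.2.2.1) (fun k => k.1.2.2.2.2.2.2.2)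
  have hp : (fun u : U => G u) ∈ LocPol U E α := by
    intro x
    obtain ⟨a, ha, hGa⟩ := hG x x.2
    refine ⟨interior {y : U | (y : (Σ j, Fin (n j)) → K) ∈ cell d x}, isOpen_interior, ?_, a,
      fun β hβ => hrN β (ha β hβ), fun y hy => hGa y ⟨y.2, ?_⟩⟩
    · rw [mem_interior_iff_mem_nhds]
      exact continuous_subtype_val.continuousAt (cell_mem_nhds hd _)
    · exact interior_subset (s := {y : U | (y : (Σ j, Fin (n j)) → K) ∈ cell d x}) hy
  refine ⟨⟨fun u => G u, isBlockC_of_mem_locPol hU hp⟩, htO ?_, hp⟩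
  refine mem_iInter₂.2 fun k hk => (hsmall ⟨k, hk⟩).congr fun x hx => ?_
  have hxU : x ∈ U := by
    obtain ⟨O, -, hO⟩ := k.2.2.2.1
    exact (hO.subset hx).1
  rw [extendZero_of_mem (fun u : U => G u) hxU]

end CAlpha
end

theorem mainTheorem9
    {K : Type*} [NontriviallyNormedField K] [IsUltrametricDist K] [CompleteSpace K]
    {E : Type*} [AddCommGroup E] [Module K E] [TopologicalSpace E] [IsTopologicalAddGroup E]
    [ContinuousSMul K E] [T2Space E] (hE : CAlpha.IsLocallyConvex K E)
    {ℓ : ℕ} (hℓ : 1 ≤ ℓ) (n : Fin ℓ → ℕ) (hn : ∀ j, 1 ≤ n j) (α : Fin ℓ → ℕ∞)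
    (U : Set ((Σ j, Fin (n j)) → K)) (hU : IsLocallyClosed U)
    (hUc : CAlpha.IsLocallyCartesian U) :
    (∀ f ∈ CAlpha.LocPol U E α, CAlpha.IsBlockC U α f) ∧
      Dense {f : CAlpha.BlockCSpace U E α | f.toFun ∈ CAlpha.LocPol U E α} :=
  ⟨fun _ hf => CAlpha.isBlockC_of_mem_locPol hUc hf, CAlpha.dense_locPol hE α hUc⟩
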